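/- **Setting.** Let $n\ge 2$ users $v\in\mathcal V$ hold finite non-empty datasets $\mathcal D_v$ and loss functions $\ell_v(\cdot,x):\mathbb R^D\to\mathbb R$ ($D\geq 1$). Put $\phi_v(\theta)=\frac1{|\mathcal D_v|}\sum_{x\in\mathcal D_v}\ell_v(\theta,x)$ and $\phi=\frac1n\sum_v\phi_v$. Assume that every $\ell_v(\cdot,x)$, $x\in\mathcal D_v$, is convex and $L$-smooth (differentiable with $L$-Lipschitz gradient) and that $\phi$ is $\mu$-strongly convex, $\mu>0$, with minimizer $\theta^\star$; let $\kappa=L/\mu$. Let $\zeta_v^2,\rho_v^2\ge0$ satisfy $\|\nabla\phi_v(\theta^\star)-\nabla\phi(\theta^\star)\|^2\le\zeta_v^2$ and $\mathbb E\|\nabla\ell_v(\theta^\star,x)-\nabla\phi_v(\theta^\star)\|^2\le\rho_v^2$ for $x$ uniform in $\mathcal D_v$, and let $\bar\zeta^2=\frac1n\sum_v\zeta_v^2$, $\bar\rho^2=\frac1n\sum_v\rho_v^2$. For each $t\ge0$ let $W_t$ be a gossip matrix over a graph on $\mathcal V$ (symmetric, non-negative entries, unit row sums, supported on the edges and the diagonal)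 such that the graph of the pairs $u\neq v$ with $(W_t)_{uv}>0$ is connected, and such that $\lambda_{W_t}\ge\lambda$ for a fixed $\lambda>0$, where $\lambda_W=\min_{x\in \mathrm{Sp}(W)\setminus\{1\}}(1-|x|)$. (For a constant matrix $W_t=W$ take $\lambda=\lambda_W$.) **Algorithm (Muffliato-SGD).** From initial points $\theta_v^0\in\mathbb R^D$, with step size $\nu>0$, noise variance $\sigma^2$ and $K$ gossip rounds per iteration, iteration $t$ is as follows. Each user draws $x_v^t$ uniformly in $\mathcal D_v$ and independently $\eta_v^t\sim\mathcal N(0,\nu^2\sigma^2 I_D)$ (all draws independent over $t$ and $v$), and sets $y_v=\theta_v^t-\nu\nabla\ell_v(\theta_v^t,x_v^t)+\eta_v^t$. Then $K$ rounds of communication compute $\theta^{t+1}=P_K(W_t)\,y$, where $P_0=1$, $P_1=X$, $P_{k+1}=\gamma XP_k+(1-\gamma)P_{k-1}$ for $k\ge1$, and $\gamma=2\,\frac{1-\sqrt{\lambda_{W_t}(1-\lambda_{W_t}/4)}}{(1-\lambda_{W_t}/2)^2}$. Muffliato-GD is the case $\ell_v=\phi_v$, where one may take $\rho_v=0$. Let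 $\bar\theta^t=\frac1n\sum_v\theta^t_v$. **Theorem.** There are absolute constants $C_1,C_2,c>0$ with the following property. In the above setting put $B=D\sigma^2+\bar\rho^2$, assume $B>0$, let $R_0=\frac1n\sum_v\|\theta_v^0-\theta^\star\|^2$ (which is $\|\theta^0-\theta^\star\|^2$ if all initial points are equal to $\theta^0$), and let $$K\ \ge\ \Big\lceil \tfrac1{\sqrt{\lambda}}\ln\Big(\max\big(n,\tfrac{\bar\zeta^2}{D\sigma^2+\bar\rho^2}\big)\Big)\Big\rceil .$$ 1. For every $T\ge1$ there are a step size $\nu>0$ and weights $\omega_t>0$ such that, for $\tilde\theta=\frac{\sum_{t<T}\omega_t\bar\theta^t}{\sum_{t<T}\omega_t}$, the quantity $\phi(\tilde\theta)-\phi(\theta^\star)$ is integrable and $$\mathbb E[\phi(\tilde\theta)-\phi(\theta^\star)]\le C_2\Big(\frac{D\sigma^2+\bar\rho^2}{n\mu T}\ln\Big(2+\frac{n\mu^2R_0T^2}{B}\Big)+L R_0\,e^{-cT/\kappa}\Big).$$ 2. In particular, for $T^{\rm stop}=\big\lceil C_1\,\kappa\,\ln\big(2+nL^2R_0/B\big)\big\rceil=\tilde{\mathcal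 O}(\kappa)$ there are a step size $\nu>0$ and weights $\omega_t>0$ such that, for $\tilde\theta^{\rm out}=\frac{\sum_{t<T^{\rm stop}}\omega_t\bar\theta^t}{\sum_{t<T^{\rm stop}}\omega_t}$, $$\mathbb E[\phi(\tilde\theta^{\rm out})-\phi(\theta^\star)]\le C_2\,\frac{D\sigma^2+\bar\rho^2}{\mu nT^{\rm stop}}\,\ln\Big(2+\frac{nL^2R_0}{B}\Big)=\tilde{\mathcal O}\Big(\frac{D\sigma^2+\bar\rho^2}{\mu nT^{\rm stop}}\Big).$$ In both cases a run of $T$ iterations uses exactly $T$ gradient computations per user and $TK$ rounds of communication. -/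

import Mathlib

open MeasureTheory ProbabilityTheory
open scoped Gradient

noncomputable section

/-- A gossip matrix over the graph `G`: symmetric, entrywise non-negative, with unit row sums, and
supported on the edges of `G` and the diagonal. -/
structure IsGossipMatrix {V : Type*} [Fintype V] (G : SimpleGraph V) (W : Matrix V V ℝ) :
    Prop where
  symm : W.IsSymm
  nonneg : ∀ u v, 0 ≤ W u v
  row_sum : ∀ u, ∑ v, W u v = 1
  supp : ∀ u v, 0 < W u v → G.Adj u v ∨ u = v

/-- The graph of the pairs of distinct nodes that do exchange information under `W`
(an edge is present when the entry of `W` is positive). -/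
def communicationGraph {V : Type*} (W : Matrix V V ℝ) : SimpleGraph V :=
  SimpleGraph.fromRel (fun u v => 0 < W u v)

/-- The spectral gap `λ_W = min_{x ∈ Sp(W) \ {1}} (1 - |x|)`. -/
def spectralGap {V : Type*} [Fintype V] [DecidableEq V] (W : Matrix V V ℝ) : ℝ :=
  sInf ((fun x : ℝ => 1 - |x|) '' (spectrum ℝ W \ {1}))

/-- The acceleration parameter `γ` used by noisy accelerated gossip with matrix `W`. -/
def accelerationParameter {V : Type*} [Fintype V] [DecidableEq V] (W : Matrix V V ℝ) : ℝ :=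
  2 * (1 - Real.sqrt (spectralGap W * (1 - spectralGap W / 4))) / (1 - spectralGap W / 2) ^ 2

/-- State of the network: the values held by the nodes before (`prev`) and after (`cur`) the last
gossip round, and two cost counters: the number of (stochastic) gradients computed by each node and
the number of rounds of communication. -/
structure NetworkState (V : Type*) (D : ℕ) where
  prev : V → EuclideanSpace ℝ (Fin D)
  cur : V → EuclideanSpace ℝ (Fin D)
  gradientSteps : ℕ
  communications : ℕ

/-- Every node computes one gradient (given by `g v`) at its current value, and makes a step of
size `ν`. Costs one gradient computation per node. -/
def localGradientStep {V : Type*} {D : ℕ} (ν : ℝ)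
    (g : V → EuclideanSpace ℝ (Fin D) → EuclideanSpace ℝ (Fin D))
    (s : NetworkState V D) : NetworkState V D where
  prev := s.prev
  cur := fun v => s.cur v - ν • g v (s.cur v)
  gradientSteps := s.gradientSteps + 1
  communications := s.communications

/-- One plain averaging round `x ↦ W x`. Costs one communication. -/
def plainRound {V : Type*} [Fintype V] {D : ℕ} (W : Matrix V V ℝ)
    (s : NetworkState V D) : NetworkState V D where
  prev := s.cur
  cur := fun v => ∑ w, W v w • s.cur w
  gradientSteps := s.gradientSteps
  communications := s.communications + 1

/-- One accelerated averaging round `x^{k+1} = (1 - γ) x^{k-1} + γ W x^k`.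
Costs one communication. -/
def acceleratedRound {V : Type*} [Fintype V] {D : ℕ} (W : Matrix V V ℝ) (γ : ℝ)
    (s : NetworkState V D) : NetworkState V D where
  prev := s.cur
  cur := fun v => (1 - γ) • s.prev v + γ • ∑ w, W v w • s.cur w
  gradientSteps := s.gradientSteps
  communications := s.communications + 1

/-- `K` rounds of accelerated gossip: `x^K = P_K(W) x^0`, with the re-scaled Chebyshev polynomials
`P_0 = 1`, `P_1 = X`, `P_{k+1} = γ X P_k + (1 - γ) P_{k-1}`. -/
def acceleratedGossip {V : Type*} [Fintype V] [DecidableEq V] {D : ℕ} (W : Matrix V V ℝ) :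
    ℕ → NetworkState V D → NetworkState V D
  | 0, s => s
  | 1, s => plainRound W s
  | k + 2, s => acceleratedRound W (accelerationParameter W) (acceleratedGossip W (k + 1) s)

/-- Noisy accelerated gossip: every node adds its noise `η v` to its value, then
`K` rounds of accelerated gossip follow. -/
def muffliato {V : Type*} [Fintype V] [DecidableEq V] {D : ℕ} (W : Matrix V V ℝ) (K : ℕ)
    (η : V → EuclideanSpace ℝ (Fin D)) (s : NetworkState V D) : NetworkState V D :=
  acceleratedGossip W K
    { prev := s.prev
      cur := fun v => s.cur v + η v
      gradientSteps := s.gradientSteps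
      communications := s.communications }

/-- The private decentralized (stochastic) gradient algorithm, run along a realization of its
randomness: `I t v` is the index of the record of `v`'s dataset sampled at iteration `t`,
and `η t v` is the noise that `v` injects at iteration `t`. -/
def muffliatoSGD {V : Type*} [Fintype V] [DecidableEq V] {D : ℕ} {X : V → Type*} {m : V → ℕ}
    (data : ∀ v, Fin (m v) → X v) (ℓ : ∀ v, EuclideanSpace ℝ (Fin D) → X v → ℝ)
    (θ₀ : V → EuclideanSpace ℝ (Fin D)) (ν : ℝ) (W : ℕ → Matrix V V ℝ) (K : ℕ)
    (I : ∀ (_ : ℕ) (v : V), Fin (m v)) (η : ℕ → V → EuclideanSpace ℝ (Fin D)) :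
    ℕ → NetworkState V D
  | 0 => { prev := θ₀, cur := θ₀, gradientSteps := 0, communications := 0 }
  | t + 1 =>
      muffliato (W t) K (η t)
        (localGradientStep ν (fun v θ => ∇ (fun θ' => ℓ v θ' (data v (I t v))) θ)
          (muffliatoSGD data ℓ θ₀ ν W K I η t))

/-- The mean `θ̄ = (1/n) ∑_v θ_v`. -/
def nodeMean {V : Type*} [Fintype V] {D : ℕ} (θ : V → EuclideanSpace ℝ (Fin D)) :
    EuclideanSpace ℝ (Fin D) :=
  (Fintype.card V : ℝ)⁻¹ • ∑ v, θ v

/-- The weighted average `(∑_{t<T} ω_t y_t) / ∑_{t<T} ω_t`. -/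
def weightedAverage {D : ℕ} (ω : ℕ → ℝ) (y : ℕ → EuclideanSpace ℝ (Fin D)) (T : ℕ) :
    EuclideanSpace ℝ (Fin D) :=
  (∑ t ∈ Finset.range T, ω t)⁻¹ • ∑ t ∈ Finset.range T, ω t • y t

/-- The local objective `φ_v(θ) = (1/|D_v|) ∑_{x ∈ D_v} ℓ_v(θ, x)`. -/
def localObjective {V : Type*} {D : ℕ} {X : V → Type*} {m : V → ℕ}
    (data : ∀ v, Fin (m v) → X v) (ℓ : ∀ v, EuclideanSpace ℝ (Fin D) → X v → ℝ) (v : V)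
    (θ : EuclideanSpace ℝ (Fin D)) : ℝ :=
  (m v : ℝ)⁻¹ * ∑ i, ℓ v θ (data v i)

/-- The global objective `φ(θ) = (1/n) ∑_v φ_v(θ)`. -/
def globalObjective {V : Type*} [Fintype V] {D : ℕ} {X : V → Type*} {m : V → ℕ}
    (data : ∀ v, Fin (m v) → X v) (ℓ : ∀ v, EuclideanSpace ℝ (Fin D) → X v → ℝ)
    (θ : EuclideanSpace ℝ (Fin D)) : ℝ :=
  (Fintype.card V : ℝ)⁻¹ * ∑ v, localObjective data ℓ v θ

/-- `L`-smoothness: differentiable with `L`-Lipschitz gradient. -/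
def IsLSmooth {D : ℕ} (L : ℝ) (f : EuclideanSpace ℝ (Fin D) → ℝ) : Prop :=
  Differentiable ℝ f ∧ ∀ x y, ‖∇ f x - ∇ f y‖ ≤ L * ‖x - y‖

/-- The randomness of a run with step size `ν` and noise variance `σ²`: at every iteration, every
node `v` draws a uniform record of its dataset and, independently of it, a Gaussian noise of law
`N(0, ν² σ² I_D)`; the draws are independent over iterations and nodes. -/
structure IsRunRandomness {V : Type*} {D : ℕ} {m : V → ℕ} {Ω : Type*} [MeasurableSpace Ω]
    (P : Measure Ω) (ν σ : ℝ) (I : ∀ (_ : ℕ) (v : V), Ω → Fin (m v))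
    (η : ℕ → V → Ω → EuclideanSpace ℝ (Fin D)) : Prop where
  measurable_sample : ∀ t v, Measurable (I t v)
  measurable_noise : ∀ t v, Measurable (η t v)
  law : ∀ t v, P.map (fun a => (I t v a, η t v a)) =
    (uniformOn (Set.univ : Set (Fin (m v)))).prod
      (multivariateGaussian 0 ((ν ^ 2 * σ ^ 2) • (1 : Matrix (Fin D) (Fin D) ℝ)))
  indep : iIndepFun (fun (j : ℕ × V) a => (I j.1 j.2 a, η j.1 j.2 a)) P

/-- For a suitable step size `ν > 0` and suitable positive weights `ω`, every run of `T` iterations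
(`K` gossip rounds each) costs `T` gradient computations per node and `T K` communications, and the
`ω`-weighted average `θ̃` of the means `θ̄^0, …, θ̄^{T-1}` has expected sub-optimality
`E[φ(θ̃) - φ(θ⋆)] ≤ bound` (the expectation being well defined). -/
def AchievesUtility.{w} {V : Type*} [Fintype V] [DecidableEq V] {D : ℕ} {X : V → Type*}
    {m : V → ℕ} (data : ∀ v, Fin (m v) → X v) (ℓ : ∀ v, EuclideanSpace ℝ (Fin D) → X v → ℝ)
    (θstar : EuclideanSpace ℝ (Fin D)) (θ₀ : V → EuclideanSpace ℝ (Fin D)) (σ : ℝ)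
    (W : ℕ → Matrix V V ℝ) (K T : ℕ) (bound : ℝ) : Prop :=
  ∃ ν : ℝ, 0 < ν ∧ ∃ ω : ℕ → ℝ, (∀ t, 0 < ω t) ∧
    ∀ (Ω : Type w) [MeasurableSpace Ω] (P : Measure Ω) [IsProbabilityMeasure P]
      (I : ∀ (_ : ℕ) (v : V), Ω → Fin (m v)) (η : ℕ → V → Ω → EuclideanSpace ℝ (Fin D)),
      IsRunRandomness P ν σ I η →
        let run : Ω → ℕ → NetworkState V D := fun a =>
          muffliatoSGD data ℓ θ₀ ν W K (fun t v => I t v a) (fun t v => η t v a)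
        let gap : Ω → ℝ := fun a =>
          globalObjective data ℓ (weightedAverage ω (fun t => nodeMean (run a t).cur) T)
            - globalObjective data ℓ θstar
        (∀ a, (run a T).gradientSteps = T ∧ (run a T).communications = T * K) ∧
          Integrable gap P ∧ ∫ a, gap a ∂P ≤ bound

end

/-!
The run is a Markov chain on the values `θ_v` of the nodes, and the proof is a Lyapunov argument for
`Ψ = ‖θ̄ - θ⋆‖² + 8 ν L · Ξ`, where `θ̄` is the mean of the nodes and `Ξ` their mean squared
distance to it.

*Gossip.* A gossip matrix with connected communication graph fixes only the constant vectors, so in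
an orthonormal eigenbasis `K` rounds multiply every component of the deviation from the mean by
`P_K(x)` with `|x| ≤ 1 - λ`. A quadratic form in two consecutive values of the recursion is exactly
multiplied by `γ - 1` at each step; this gives `P_K(x)² ≤ 2 (γ - 1)^K ≤ 2 exp (-2 K √λ)`
(`gossipPolynomial_sq_le`, `accelerationRate_le_exp`, `acceleratedGossip_contraction`). By the choice
of `K` this factor is at most `α = 2 / N²` with `N = max n (ζ̄² / B)`, so that `α ≤ 1 / 2` and
`α (ζ̄² + B) ≤ 4 B / n`: heterogeneity becomes part of the noise term.

*Optimization.* With `G` the mean of `‖∇ℓ_v(θ_v, x) - ∇ℓ_v(θ⋆, x)‖²`, the descent lemma and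
cocoercivity show that for `ν L ≤ 1 / 8` the mean satisfies
`E ‖θ̄⁺ - θ⋆‖² ≤ ‖θ̄ - θ⋆‖² - 2 ν (φ(θ̄) - φ(θ⋆)) + ν L Ξ - (ν / 2L) G + 2 ν² B / n`
(`expected_mean_progress`; the variance is divided by `n` because the draws of the nodes are
independent), and that `E Ξ⁺ ≤ (3/4) Ξ + 3 ν² G + 24 ν² B / n`. The negative multiple of `G` absorbs
the one in the consensus error, whence
`E Ψ⁺ ≤ (1 - ν μ / 2) Ψ - ν (φ(θ̄) - φ(θ⋆)) + 26 ν² B / n` (`expected_lyapunov_iteration`).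

*Conclusion.* Current values are independent of the next draws, so this can be integrated along the
run. With weights `(1 - ν μ / 2)^{-(t+1)}` and Jensen's inequality the expected sub-optimality is at
most `(R / ν) exp (-ν μ T / 2) + 26 ν B / n` (`achievesUtility_of_stepSize`). The step size
`min (1 / (8 L), 2 ln A / (μ T))` gives the bound for every horizon (`exists_stepSize`), and at the
stopping time the exponential term is dominated by the other one (`bound_at_stoppingTime`).
-/

open MeasureTheory ProbabilityTheory
open scoped Gradient

noncomputable section

/-! ### Uniform averages over finite types -/

/-- The average `(1/|ι|) ∑ i, f i` of a finite family of vectors. -/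
def uniformMean {ι E : Type*} [Fintype ι] [AddCommGroup E] [Module ℝ E] (f : ι → E) : E :=
  (Fintype.card ι : ℝ)⁻¹ • ∑ i, f i

section UniformMean

variable {ι E : Type*} [Fintype ι] [NormedAddCommGroup E] [InnerProductSpace ℝ E]

lemma uniformMean_add (f g : ι → E) :
    uniformMean (fun i => f i + g i) = uniformMean f + uniformMean g := by
  simp [uniformMean, Finset.sum_add_distrib]

lemma uniformMean_sub (f g : ι → E) :
    uniformMean (fun i => f i - g i) = uniformMean f - uniformMean g := by
  simp [uniformMean, Finset.sum_sub_distrib, smul_sub]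

lemma uniformMean_smul (c : ℝ) (f : ι → E) :
    uniformMean (fun i => c • f i) = c • uniformMean f := by
  simp [uniformMean, ← Finset.smul_sum, smul_comm c]

lemma uniformMean_mul (c : ℝ) (f : ι → ℝ) :
    uniformMean (fun i => c * f i) = c * uniformMean f :=
  uniformMean_smul c f

lemma uniformMean_const [Nonempty ι] (c : E) : uniformMean (fun _ : ι => c) = c := by
  have : (Fintype.card ι : ℝ) ≠ 0 := by positivity
  simp only [uniformMean, Finset.sum_const, Finset.card_univ, ← Nat.cast_smul_eq_nsmul ℝ, smul_smul]
  rw [inv_mul_cancel₀ this, one_smul]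

lemma card_mul_uniformMean [Nonempty ι] (f : ι → ℝ) :
    Fintype.card ι * uniformMean f = ∑ i, f i := by
  rw [uniformMean, smul_eq_mul, mul_inv_cancel_left₀ (by positivity)]

lemma uniformMean_mono {f g : ι → ℝ} (h : ∀ i, f i ≤ g i) : uniformMean f ≤ uniformMean g :=
  smul_le_smul_of_nonneg_left (Finset.sum_le_sum fun i _ => h i) (by positivity)

lemma uniformMean_nonneg {f : ι → ℝ} (h : ∀ i, 0 ≤ f i) : 0 ≤ uniformMean f :=
  smul_nonneg (by positivity) (Finset.sum_nonneg fun i _ => h i)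

lemma inner_uniformMean (x : E) (f : ι → E) :
    inner ℝ x (uniformMean f) = uniformMean (fun i => inner ℝ x (f i)) := by
  simp [uniformMean, inner_smul_right, inner_sum]

/-- Bias-variance decomposition. -/
lemma uniformMean_norm_sub_sq [Nonempty ι] (f : ι → E) (c : E) :
    uniformMean (fun i => ‖f i - c‖ ^ 2)
      = uniformMean (fun i => ‖f i - uniformMean f‖ ^ 2) + ‖uniformMean f - c‖ ^ 2 := by
  set m := uniformMean f with hm
  have h (i : ι) : ‖f i - c‖ ^ 2
      = (‖f i - m‖ ^ 2 + ‖m - c‖ ^ 2) + 2 * inner ℝ (m - c) (f i - m) := by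
    rw [show f i - c = (f i - m) + (m - c) by abel, norm_add_sq_real, real_inner_comm]
    ring
  simp_rw [h, uniformMean_add, uniformMean_const, uniformMean_mul, ← inner_uniformMean,
    uniformMean_sub, uniformMean_const, ← hm]
  simp

lemma norm_uniformMean_sq_le [Nonempty ι] (f : ι → E) :
    ‖uniformMean f‖ ^ 2 ≤ uniformMean (fun i => ‖f i‖ ^ 2) := by
  have h := uniformMean_norm_sub_sq f 0
  have := uniformMean_nonneg (fun i => sq_nonneg ‖f i - uniformMean f‖)
  simp only [sub_zero] at h
  linarith

lemma uniformMean_norm_sub_mean_sq_le [Nonempty ι] (f : ι → E) (c : E) :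
    uniformMean (fun i => ‖f i - uniformMean f‖ ^ 2) ≤ uniformMean (fun i => ‖f i - c‖ ^ 2) := by
  rw [uniformMean_norm_sub_sq f c]
  exact le_add_of_nonneg_right (sq_nonneg _)

end UniformMean

/-! ### Smooth and strongly convex functions -/

section Smooth

variable {D : ℕ} {f : EuclideanSpace ℝ (Fin D) → ℝ} {L : ℝ}

lemma hasDerivAt_comp_segment (hf : Differentiable ℝ f)
    (x d : EuclideanSpace ℝ (Fin D)) (t : ℝ) :
    HasDerivAt (fun t : ℝ => f (x + t • d)) (inner ℝ (∇ f (x + t • d)) d) t := by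
  have h1 : HasDerivAt (fun t : ℝ => x + t • d) d t := by
    simpa using ((hasDerivAt_id t).smul_const d).const_add x
  rw [inner_gradient_left]
  exact (hf (x + t • d)).hasFDerivAt.comp_hasDerivAt t h1

/-- The descent lemma. -/
lemma IsLSmooth.le_quadratic (hf : IsLSmooth L f) (x y : EuclideanSpace ℝ (Fin D)) :
    f y ≤ f x + inner ℝ (∇ f x) (y - x) + L / 2 * ‖y - x‖ ^ 2 := by
  set d := y - x with hd
  have hder (t : ℝ) : HasDerivAt
      (fun t : ℝ => f (x + t • d) - t * inner ℝ (∇ f x) d - L / 2 * t ^ 2 * ‖d‖ ^ 2)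
      (inner ℝ (∇ f (x + t • d)) d - inner ℝ (∇ f x) d - L * t * ‖d‖ ^ 2) t := by
    have h := ((hasDerivAt_comp_segment hf.1 x d t).sub
      ((hasDerivAt_id t).mul_const (inner ℝ (∇ f x) d))).sub
      ((((hasDerivAt_id t).pow 2).const_mul (L / 2)).mul_const (‖d‖ ^ 2))
    refine h.congr_deriv ?_
    simp only [id]
    push_cast
    ring
  have hanti : AntitoneOn
      (fun t : ℝ => f (x + t • d) - t * inner ℝ (∇ f x) d - L / 2 * t ^ 2 * ‖d‖ ^ 2)
      (Set.Icc 0 1) := by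
    refine antitoneOn_of_deriv_nonpos (convex_Icc 0 1)
      (fun t _ => (hder t).continuousAt.continuousWithinAt)
      (fun t _ => (hder t).differentiableAt.differentiableWithinAt) fun t ht => ?_
    rw [interior_Icc] at ht
    rw [(hder t).deriv, ← inner_sub_left]
    have h1 := real_inner_le_norm (∇ f (x + t • d) - ∇ f x) d
    have h2 := hf.2 (x + t • d) x
    rw [add_sub_cancel_left, norm_smul, Real.norm_of_nonneg ht.1.le] at h2
    nlinarith [norm_nonneg d]
  have h := hanti (Set.left_mem_Icc.2 zero_le_one) (Set.right_mem_Icc.2 zero_le_one) zero_le_one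
  simp only [one_smul, zero_smul, add_zero] at h
  rw [show x + d = y by rw [hd]; abel] at h
  linarith

lemma ConvexOn.gradient_le (hc : ConvexOn ℝ Set.univ f) (hf : Differentiable ℝ f)
    (x y : EuclideanSpace ℝ (Fin D)) : f x + inner ℝ (∇ f x) (y - x) ≤ f y := by
  have hd := hasDerivAt_comp_segment hf x (y - x) 0
  have hc' : ConvexOn ℝ Set.univ (fun t : ℝ => f (x + t • (y - x))) := by
    have := hc.comp_affineMap (AffineMap.lineMap x y : ℝ →ᵃ[ℝ] EuclideanSpace ℝ (Fin D))
    simpa [AffineMap.lineMap_apply, Function.comp_def, add_comm] using this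
  have h := hc'.le_slope_of_hasDerivAt (Set.mem_univ 0) (Set.mem_univ 1) zero_lt_one hd
  simp only [zero_smul, add_zero, slope_def_field, one_smul, add_sub_cancel, sub_zero,
    div_one] at h
  linarith

/-- Cocoercivity of the gradient of a convex smooth function, in terms of function values. -/
lemma IsLSmooth.gradient_sub_sq_le (hf : IsLSmooth L f) (hL : 0 < L)
    (hc : ConvexOn ℝ Set.univ f) (x y : EuclideanSpace ℝ (Fin D)) :
    f x + inner ℝ (∇ f x) (y - x) + 1 / (2 * L) * ‖∇ f x - ∇ f y‖ ^ 2 ≤ f y := by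
  -- compare the two bounds at the gradient step from `y` for `f - ⟪∇ f x, ·⟫`
  set d := ∇ f y - ∇ f x with hd
  have h1 := hc.gradient_le hf.1 x (y - L⁻¹ • d)
  have h2 := hf.le_quadratic y (y - L⁻¹ • d)
  have e1 : y - L⁻¹ • d - x = (y - x) - L⁻¹ • d := by abel
  have e2 : y - L⁻¹ • d - y = -(L⁻¹ • d) := by abel
  rw [e1, inner_sub_right, inner_smul_right] at h1
  rw [e2, inner_neg_right, inner_smul_right, norm_neg, norm_smul, mul_pow,
    Real.norm_of_nonneg (inv_nonneg.2 hL.le)] at h2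
  have h3 : inner ℝ (∇ f y) d - inner ℝ (∇ f x) d = ‖d‖ ^ 2 := by
    rw [← inner_sub_left, real_inner_self_eq_norm_sq]
  rw [norm_sub_rev, ← hd]
  have h4 : L / 2 * (L⁻¹ ^ 2 * ‖d‖ ^ 2) = L⁻¹ / 2 * ‖d‖ ^ 2 := by field_simp
  have h5 : 1 / (2 * L) * ‖d‖ ^ 2 = L⁻¹ / 2 * ‖d‖ ^ 2 := by field_simp
  have h6 : L⁻¹ * inner ℝ (∇ f y) d = L⁻¹ * inner ℝ (∇ f x) d + L⁻¹ * ‖d‖ ^ 2 := by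
    rw [← h3]; ring
  rw [h4] at h2
  rw [h5]
  linarith

/-- A gradient taken at `x` is still a good direction from `a` towards `s`, up to `‖a - x‖²`. -/
lemma IsLSmooth.inner_gradient_ge (hf : IsLSmooth L f) (hL : 0 < L)
    (hc : ConvexOn ℝ Set.univ f) (a s x : EuclideanSpace ℝ (Fin D)) :
    f a - f s - L / 2 * ‖x - a‖ ^ 2 + 1 / (2 * L) * ‖∇ f x - ∇ f s‖ ^ 2
      ≤ inner ℝ (a - s) (∇ f x) := by
  have h1 := hf.le_quadratic x a
  have h2 := hf.gradient_sub_sq_le hL hc x s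
  rw [norm_sub_rev] at h1
  rw [real_inner_comm, show a - s = (a - x) - (s - x) by abel, inner_sub_right]
  linarith

/-- Strong convexity gives quadratic growth away from a minimizer. -/
lemma StrongConvexOn.quadratic_growth {μ : ℝ} (hf : StrongConvexOn Set.univ μ f)
    {s : EuclideanSpace ℝ (Fin D)} (hs : ∀ x, f s ≤ f x) (x : EuclideanSpace ℝ (Fin D)) :
    μ / 2 * ‖x - s‖ ^ 2 ≤ f x - f s := by
  have key : ∀ a ∈ Set.Ioo (0 : ℝ) 1, (1 - a) * (μ / 2 * ‖x - s‖ ^ 2) ≤ f x - f s := by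
    intro a ha
    have h := hf.2 (Set.mem_univ x) (Set.mem_univ s) ha.1.le (sub_nonneg.2 ha.2.le)
      (add_sub_cancel a 1)
    have h2 := hs (a • x + (1 - a) • s)
    simp only [smul_eq_mul] at h
    have h3 : a * ((1 - a) * (μ / 2 * ‖x - s‖ ^ 2)) ≤ a * (f x - f s) := by nlinarith
    exact le_of_mul_le_mul_left h3 ha.1
  have hlim : Filter.Tendsto (fun a : ℝ => (1 - a) * (μ / 2 * ‖x - s‖ ^ 2))
      (nhdsWithin 0 (Set.Ioi 0)) (nhds ((1 - 0) * (μ / 2 * ‖x - s‖ ^ 2))) :=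
    (Continuous.tendsto (by fun_prop) 0).mono_left nhdsWithin_le_nhds
  rw [sub_zero, one_mul] at hlim
  refine le_of_tendsto hlim ?_
  filter_upwards [Ioo_mem_nhdsGT zero_lt_one] with a ha using key a ha

lemma IsLSmooth.continuous_gradient (hf : IsLSmooth L f) : Continuous (∇ f) := by
  have : LipschitzWith L.toNNReal (∇ f) := LipschitzWith.of_dist_le_mul fun x y => by
    rw [dist_eq_norm, dist_eq_norm]
    exact (hf.2 x y).trans
      (mul_le_mul_of_nonneg_right (Real.le_coe_toNNReal L) (norm_nonneg _))
  exact this.continuous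

lemma gradient_eq_zero_of_forall_le {s : EuclideanSpace ℝ (Fin D)} (hs : ∀ x, f s ≤ f x) :
    ∇ f s = 0 := by
  have h : IsLocalMin f s := Filter.Eventually.of_forall hs
  simp [gradient, h.fderiv_eq_zero]

lemma gradient_uniformMean {ι : Type*} [Fintype ι] {F : ι → EuclideanSpace ℝ (Fin D) → ℝ}
    (hF : ∀ i, Differentiable ℝ (F i)) (x : EuclideanSpace ℝ (Fin D)) :
    ∇ (fun y => uniformMean fun i => F i y) x = uniformMean fun i => ∇ (F i) x := by
  have h : HasFDerivAt (fun y => uniformMean fun i => F i y)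
      ((Fintype.card ι : ℝ)⁻¹ • ∑ i, fderiv ℝ (F i) x) x := by
    exact (HasFDerivAt.fun_sum fun i _ => (hF i x).hasFDerivAt).const_smul (Fintype.card ι : ℝ)⁻¹
  rw [gradient, h.fderiv]
  simp [uniformMean, gradient]

lemma differentiable_uniformMean {ι : Type*} [Fintype ι] {F : ι → EuclideanSpace ℝ (Fin D) → ℝ}
    (hF : ∀ i, Differentiable ℝ (F i)) : Differentiable ℝ (fun y => uniformMean fun i => F i y) := by
  unfold uniformMean
  fun_prop

lemma IsLSmooth.uniformMean {ι : Type*} [Fintype ι] [Nonempty ι]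
    {F : ι → EuclideanSpace ℝ (Fin D) → ℝ} (hF : ∀ i, IsLSmooth L (F i)) :
    IsLSmooth L (fun y => uniformMean fun i => F i y) := by
  refine ⟨differentiable_uniformMean fun i => (hF i).1, fun x y => ?_⟩
  rw [gradient_uniformMean fun i => (hF i).1, gradient_uniformMean fun i => (hF i).1,
    ← uniformMean_sub]
  calc ‖_root_.uniformMean fun i => ∇ (F i) x - ∇ (F i) y‖
      ≤ _root_.uniformMean fun i => ‖∇ (F i) x - ∇ (F i) y‖ := by
        rw [_root_.uniformMean, norm_smul, Real.norm_of_nonneg (by positivity)]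
        exact mul_le_mul_of_nonneg_left (norm_sum_le _ _) (by positivity)
    _ ≤ _root_.uniformMean fun _ : ι => L * ‖x - y‖ := uniformMean_mono fun i => (hF i).2 x y
    _ = L * ‖x - y‖ := uniformMean_const _

end Smooth

/-! ### The polynomials of accelerated gossip -/

/-- The polynomials `P_0 = 1`, `P_1 = X`, `P_{k+1} = γ X P_k + (1 - γ) P_{k-1}`, evaluated at an
element `x` of an arbitrary real algebra (below: at gossip matrices, and at their eigenvalues). -/
def gossipPolynomial {A : Type*} [Ring A] [Algebra ℝ A] (γ : ℝ) (x : A) : ℕ → A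
  | 0 => 1
  | 1 => x
  | k + 2 => γ • (x * gossipPolynomial γ x (k + 1)) + (1 - γ) • gossipPolynomial γ x k

lemma gossipPolynomial_one (γ : ℝ) : ∀ k, gossipPolynomial γ (1 : ℝ) k = 1
  | 0 => rfl
  | 1 => rfl
  | k + 2 => by
    simp [gossipPolynomial, gossipPolynomial_one γ (k + 1), gossipPolynomial_one γ k]

/-- A quadratic form in two consecutive values is multiplied by `γ - 1` at each step. -/
lemma gossipPolynomial_invariant (γ x : ℝ) (k : ℕ) :
    gossipPolynomial γ x (k + 1) ^ 2
      - γ * x * gossipPolynomial γ x (k + 1) * gossipPolynomial γ x k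
      + (γ - 1) * gossipPolynomial γ x k ^ 2 = (γ - 1) ^ (k + 1) * (1 - x ^ 2) := by
  induction k with
  | zero => simp [gossipPolynomial]; ring
  | succ k ih =>
    simp only [gossipPolynomial, smul_eq_mul] at ih ⊢
    linear_combination (γ - 1) * ih

/-- With the tuned parameter `γ = 2 / (1 + s)`, `s² = 1 - (1 - l/2)²`, the values of `P_k` on
`[-(1-l), 1-l]` decay like `(γ - 1)^{k/2}`. -/
lemma gossipPolynomial_sq_le {l s γ x : ℝ} (hl : 0 < l) (hl1 : l ≤ 1) (hs : 0 < s)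
    (hs2 : s ^ 2 = l * (1 - l / 4)) (hγ : γ * (1 + s) = 2) (hx : |x| ≤ 1 - l) (k : ℕ) :
    gossipPolynomial γ x k ^ 2 ≤ 2 * (γ - 1) ^ k := by
  have hγ0 : 0 < γ := by
    by_contra! h
    nlinarith
  have hs1 : s < 1 := by nlinarith
  have ha0 : 0 ≤ γ - 1 := by nlinarith
  have ha : γ - 1 = γ ^ 2 / 4 * (1 - l / 2) ^ 2 := by
    have h2 : (1 - l / 2) ^ 2 = (1 - s) * (1 + s) := by linear_combination hs2
    rw [h2]
    linear_combination (γ * s / 4 - γ / 4 + 1 / 2) * hγ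
  have hinv := gossipPolynomial_invariant γ x k
  set p := gossipPolynomial γ x k
  set p' := gossipPolynomial γ x (k + 1)
  have hx2 : x ^ 2 ≤ (1 - l) ^ 2 := by
    rw [← sq_abs]; exact pow_le_pow_left₀ (abs_nonneg x) hx 2
  have hpos : 0 < (1 - l / 2) ^ 2 - x ^ 2 := by nlinarith
  have h1 : γ ^ 2 / 4 * (p ^ 2 * ((1 - l / 2) ^ 2 - x ^ 2))
      ≤ γ ^ 2 / 4 * ((γ - 1) ^ k * ((1 - l / 2) ^ 2 * (1 - x ^ 2))) := by
    have e1 : γ ^ 2 / 4 * ((γ - 1) ^ k * ((1 - l / 2) ^ 2 * (1 - x ^ 2)))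
        = (γ - 1) ^ (k + 1) * (1 - x ^ 2) := by
      rw [pow_succ]
      linear_combination (-(γ - 1) ^ k * (1 - x ^ 2)) * ha
    have e2 : γ ^ 2 / 4 * (p ^ 2 * ((1 - l / 2) ^ 2 - x ^ 2))
        = (γ - 1) * p ^ 2 - γ ^ 2 * x ^ 2 / 4 * p ^ 2 := by
      linear_combination (-p ^ 2) * ha
    rw [e1, e2, ← hinv]
    nlinarith [sq_nonneg (p' - γ * x * p / 2)]
  have h2 : p ^ 2 * ((1 - l / 2) ^ 2 - x ^ 2)
      ≤ (γ - 1) ^ k * ((1 - l / 2) ^ 2 * (1 - x ^ 2)) :=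
    le_of_mul_le_mul_left h1 (by positivity)
  have h3 : (1 - l / 2) ^ 2 * (1 - x ^ 2) ≤ 2 * ((1 - l / 2) ^ 2 - x ^ 2) := by
    have : x ^ 2 * (2 - (1 - l / 2) ^ 2) ≤ (1 - l) ^ 2 * (2 - (1 - l / 2) ^ 2) :=
      mul_le_mul_of_nonneg_right hx2 (by nlinarith)
    have : (1 - l) ^ 2 * (2 - (1 - l / 2) ^ 2) ≤ (1 - l / 2) ^ 2 := by
      have h4 : 0 ≤ l ^ 2 * (3 / 2 * (1 - l) + l ^ 2 / 4) := by
        have := sub_nonneg.2 hl1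
        positivity
      nlinarith
    linarith
  have h4 : (γ - 1) ^ k * ((1 - l / 2) ^ 2 * (1 - x ^ 2))
      ≤ (γ - 1) ^ k * (2 * ((1 - l / 2) ^ 2 - x ^ 2)) :=
    mul_le_mul_of_nonneg_left h3 (pow_nonneg ha0 k)
  have h5 : p ^ 2 * ((1 - l / 2) ^ 2 - x ^ 2)
      ≤ (2 * (γ - 1) ^ k) * ((1 - l / 2) ^ 2 - x ^ 2) := by linarith
  exact le_of_mul_le_mul_right h5 hpos

/-- The rate `γ - 1 = (1 - s) / (1 + s)` is at most `exp (-2 √l)`, from the first two terms of the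
series of `artanh s`. -/
lemma accelerationRate_le_exp {l s γ : ℝ} (hl : 0 < l) (hl1 : l ≤ 1) (hs : 0 < s)
    (hs2 : s ^ 2 = l * (1 - l / 4)) (hγ : γ * (1 + s) = 2) :
    γ - 1 ≤ Real.exp (-(2 * Real.sqrt l)) := by
  have hs1 : s < 1 := by nlinarith
  have hlog := Real.sum_range_le_log_div hs.le hs1 2
  simp only [Finset.sum_range_succ, Finset.sum_range_zero] at hlog
  norm_num at hlog
  have hu : Real.sqrt l ≤ s + s ^ 3 / 3 := by
    refine Real.sqrt_le_iff.2 ⟨by positivity, ?_⟩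
    have e : (s + s ^ 3 / 3) ^ 2 = s ^ 2 * (1 + s ^ 2 / 3) ^ 2 := by ring
    have h1 : 1 + s ^ 2 * (2 / 3) ≤ (1 + s ^ 2 / 3) ^ 2 := by nlinarith [sq_nonneg (s ^ 2)]
    have h2 : l * 1 ≤ l * ((1 - l / 4) * (1 + l * (1 - l / 4) * (2 / 3))) := by
      refine mul_le_mul_of_nonneg_left ?_ hl.le
      nlinarith [mul_nonneg hl.le (sub_nonneg.2 hl1),
        mul_nonneg (mul_nonneg hl.le hl.le) (sub_nonneg.2 hl1)]
    rw [e]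
    calc l ≤ l * ((1 - l / 4) * (1 + l * (1 - l / 4) * (2 / 3))) := by linarith
      _ = s ^ 2 * (1 + s ^ 2 * (2 / 3)) := by rw [hs2]; ring
      _ ≤ _ := mul_le_mul_of_nonneg_left h1 (sq_nonneg s)
  have hle : 2 * Real.sqrt l ≤ Real.log ((1 + s) / (1 - s)) := by linarith
  have hpos : 0 < (1 + s) / (1 - s) := div_pos (by linarith) (by linarith)
  have hexp := (Real.le_log_iff_exp_le hpos).1 hle
  have hγ' : γ - 1 = ((1 + s) / (1 - s))⁻¹ := by
    rw [inv_div, eq_div_iff (by linarith)]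
    linear_combination hγ
  rw [hγ', Real.exp_neg]
  exact inv_anti₀ (Real.exp_pos _) hexp

/-! ### Spectral analysis of a gossip matrix -/

section Projection

variable {V : Type*} [Fintype V] {D : ℕ} {G : SimpleGraph V} {W : Matrix V V ℝ}

/-- An eigenvector of a gossip matrix for the eigenvalue `1` is constant: its Dirichlet form
`∑ W u v (e u - e v)²` vanishes and the communication graph is connected. -/
lemma IsGossipMatrix.eq_of_mulVec_eq (hW : IsGossipMatrix G W)
    (hc : (communicationGraph W).Connected) {e : V → ℝ} (he : W.mulVec e = e) (u v : V) :
    e u = e v := by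
  have hsum : ∑ u, ∑ v, W u v * (e u - e v) ^ 2 = 0 := by
    have h1 : ∑ u, ∑ v, W u v * e u ^ 2 = ∑ u, e u ^ 2 := by
      simp_rw [← Finset.sum_mul, hW.row_sum, one_mul]
    have h2 : ∑ u, ∑ v, W u v * e v ^ 2 = ∑ u, e u ^ 2 := by
      rw [Finset.sum_comm]
      simp_rw [fun u v => hW.symm.apply u v]
      exact h1
    have h3 : ∑ u, ∑ v, W u v * (e u * e v) = ∑ u, e u ^ 2 := by
      refine Finset.sum_congr rfl fun u _ => ?_
      have := congrFun he u
      simp only [Matrix.mulVec, dotProduct] at this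
      calc ∑ v, W u v * (e u * e v) = e u * ∑ v, W u v * e v := by
            rw [Finset.mul_sum]
            exact Finset.sum_congr rfl fun v _ => by ring
        _ = e u ^ 2 := by rw [this, sq]
    have h4 : ∑ u, ∑ v, W u v * (e u - e v) ^ 2
        = ∑ u, ∑ v, W u v * e u ^ 2 + ∑ u, ∑ v, W u v * e v ^ 2
          - 2 * ∑ u, ∑ v, W u v * (e u * e v) := by
      simp_rw [Finset.mul_sum, ← Finset.sum_add_distrib, ← Finset.sum_sub_distrib]
      exact Finset.sum_congr rfl fun u _ => Finset.sum_congr rfl fun v _ => by ring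
    rw [h4, h1, h2, h3]
    ring
  have hterm (u v : V) (huv : 0 < W u v) : e u = e v := by
    have h0 (u v : V) : 0 ≤ W u v * (e u - e v) ^ 2 := mul_nonneg (hW.nonneg u v) (sq_nonneg _)
    have h1 := (Finset.sum_eq_zero_iff_of_nonneg fun u _ =>
      Finset.sum_nonneg fun v _ => h0 u v).1 hsum u (Finset.mem_univ u)
    have h2 := (Finset.sum_eq_zero_iff_of_nonneg fun v _ => h0 u v).1 h1 v (Finset.mem_univ v)
    have h3 := (mul_eq_zero.1 h2).resolve_left huv.ne'
    exact sub_eq_zero.1 (pow_eq_zero_iff two_ne_zero |>.1 h3)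
  obtain ⟨w⟩ := hc.preconnected u v
  induction w with
  | nil => rfl
  | cons hadj _ ih =>
    refine Eq.trans ?_ ih
    rw [communicationGraph, SimpleGraph.fromRel_adj] at hadj
    exact hadj.2.elim (hterm _ _) fun h => (hterm _ _ h).symm

/-- Parseval's identity for vector-valued functions on the nodes. -/
lemma sum_norm_sum_smul_sq (b : OrthonormalBasis V ℝ (EuclideanSpace ℝ V))
    (x : V → EuclideanSpace ℝ (Fin D)) :
    ∑ j, ‖∑ v, b j v • x v‖ ^ 2 = ∑ v, ‖x v‖ ^ 2 := by
  simp_rw [EuclideanSpace.real_norm_sq_eq]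
  rw [Finset.sum_comm, Finset.sum_comm (s := (Finset.univ : Finset V))]
  refine Finset.sum_congr rfl fun i _ => ?_
  have h := b.sum_sq_inner_right (WithLp.toLp 2 fun v => x v i)
  rw [EuclideanSpace.real_norm_sq_eq] at h
  rw [← h]
  refine Finset.sum_congr rfl fun j _ => ?_
  congr 1
  simp [PiLp.inner_apply, mul_comm]

/-- Projecting the deviations from the mean on an eigenvector which is either constant or orthogonal
to the constants. -/
lemma sum_smul_sub_nodeMean [Nonempty V] (e : V → ℝ) (x : V → EuclideanSpace ℝ (Fin D)) :
    ((∀ u v, e u = e v) → ∑ v, e v • (x v - nodeMean x) = 0) ∧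
    (∑ v, e v = 0 → ∑ v, e v • (x v - nodeMean x) = ∑ v, e v • x v) := by
  constructor
  · intro h
    obtain ⟨u⟩ := ‹Nonempty V›
    have hn : (Fintype.card V : ℝ) ≠ 0 := by
      have : Nonempty V := ⟨u⟩
      positivity
    simp_rw [fun v => h v u, ← Finset.smul_sum, Finset.sum_sub_distrib, Finset.sum_const,
      Finset.card_univ, ← Nat.cast_smul_eq_nsmul ℝ, nodeMean, smul_smul, mul_inv_cancel₀ hn,
      one_smul, sub_self, smul_zero]
  · intro h
    simp_rw [smul_sub, Finset.sum_sub_distrib, ← Finset.sum_smul, h, zero_smul, sub_zero]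

end Projection

section Gossip

variable {V : Type*} [Fintype V] [DecidableEq V] {D : ℕ} {G : SimpleGraph V} {W : Matrix V V ℝ}

lemma spectralGap_le_of_mem {x : ℝ} (hx : x ∈ spectrum ℝ W) (hx1 : x ≠ 1) :
    spectralGap W ≤ 1 - |x| :=
  csInf_le ((W.finite_real_spectrum.subset Set.sdiff_subset).image _).bddBelow
    ⟨x, ⟨hx, hx1⟩, rfl⟩

/-- A positive spectral gap forces a second eigenvalue: for an empty infimum the gap is `0`. -/
lemma exists_mem_spectrum_ne_one (h : 0 < spectralGap W) : ∃ x ∈ spectrum ℝ W, x ≠ 1 := by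
  by_contra! hall
  have : spectrum ℝ W \ {1} = ∅ := Set.eq_empty_of_forall_notMem fun x hx => hx.2 (hall x hx.1)
  simp [spectralGap, this] at h

lemma spectralGap_le_one (h : 0 < spectralGap W) : spectralGap W ≤ 1 := by
  obtain ⟨x, hx, hx1⟩ := exists_mem_spectrum_ne_one h
  linarith [spectralGap_le_of_mem hx hx1, abs_nonneg x]

lemma IsGossipMatrix.two_le_card [Nonempty V] (hW : IsGossipMatrix G W) (h : 0 < spectralGap W) :
    2 ≤ Fintype.card V := by
  by_contra! hlt
  have : Subsingleton V := Fintype.card_le_one_iff_subsingleton.1 (by omega)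
  have hW1 : W = 1 := by
    ext u v
    have := hW.row_sum u
    rw [Fintype.sum_subsingleton _ u] at this
    rw [Subsingleton.elim v u, this, Matrix.one_apply_eq]
  obtain ⟨x, hx, hx1⟩ := exists_mem_spectrum_ne_one h
  rw [hW1, spectrum.one_eq] at hx
  exact hx1 hx

lemma accelerationParameter_mul {s : ℝ} (h : 0 < spectralGap W)
    (hs : s = Real.sqrt (spectralGap W * (1 - spectralGap W / 4))) :
    accelerationParameter W * (1 + s) = 2 := by
  have h1 := spectralGap_le_one h
  have hs2 : s ^ 2 = spectralGap W * (1 - spectralGap W / 4) := by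
    rw [hs, Real.sq_sqrt (mul_nonneg h.le (by linarith))]
  rw [accelerationParameter, ← hs, div_mul_eq_mul_div, div_eq_iff (by nlinarith)]
  linear_combination (-2) * hs2

lemma vecMul_gossipPolynomial (γ : ℝ) {e : V → ℝ} {x : ℝ} (he : Matrix.vecMul e W = x • e) :
    ∀ k, Matrix.vecMul e (gossipPolynomial γ W k) = gossipPolynomial γ x k • e
  | 0 => by simp [gossipPolynomial]
  | 1 => he
  | k + 2 => by
    simp only [gossipPolynomial, Matrix.vecMul_add, Matrix.vecMul_smul, ← Matrix.vecMul_vecMul, he,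
      Matrix.smul_vecMul, vecMul_gossipPolynomial γ he k, vecMul_gossipPolynomial γ he (k + 1)]
    ext v
    simp
    ring

lemma acceleratedGossip_prev (s : NetworkState V D) :
    ∀ k, (acceleratedGossip W (k + 1) s).prev = (acceleratedGossip W k s).cur
  | 0 => rfl
  | _ + 1 => rfl

lemma acceleratedGossip_cur (s : NetworkState V D) :
    ∀ (k : ℕ) (v : V), (acceleratedGossip W k s).cur v
      = ∑ w, gossipPolynomial (accelerationParameter W) W k v w • s.cur w
  | 0, v => by simp [acceleratedGossip, gossipPolynomial, Matrix.one_apply]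
  | 1, v => rfl
  | k + 2, v => by
    simp only [acceleratedGossip, acceleratedRound, acceleratedGossip_prev,
      acceleratedGossip_cur s k, acceleratedGossip_cur s (k + 1), gossipPolynomial,
      Matrix.add_apply, Matrix.smul_apply, Matrix.mul_apply, add_smul, Finset.sum_add_distrib,
      smul_eq_mul, Finset.smul_sum, Finset.sum_smul, Finset.mul_sum, smul_smul]
    rw [add_comm, Finset.sum_comm]

lemma acceleratedGossip_gradientSteps (s : NetworkState V D) :
    ∀ k, (acceleratedGossip W k s).gradientSteps = s.gradientSteps
  | 0 => rfl
  | 1 => rfl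
  | k + 2 => acceleratedGossip_gradientSteps s (k + 1)

lemma acceleratedGossip_communications (s : NetworkState V D) :
    ∀ k, (acceleratedGossip W k s).communications = s.communications + k
  | 0 => rfl
  | 1 => rfl
  | k + 2 => by
    simp [acceleratedGossip, acceleratedRound, acceleratedGossip_communications s (k + 1)]
    omega

lemma IsGossipMatrix.nodeMean_acceleratedGossip (hW : IsGossipMatrix G W) (K : ℕ)
    (s : NetworkState V D) : nodeMean (acceleratedGossip W K s).cur = nodeMean s.cur := by
  have h1 : Matrix.vecMul 1 W = (1 : ℝ) • (1 : V → ℝ) := by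
    ext v
    simp only [Matrix.vecMul, dotProduct, Pi.one_apply, one_mul, one_smul]
    simp_rw [← hW.row_sum v, fun u => hW.symm.apply u v]
  have h2 := vecMul_gossipPolynomial (accelerationParameter W) h1 K
  rw [gossipPolynomial_one, one_smul] at h2
  simp only [nodeMean, acceleratedGossip_cur]
  rw [Finset.sum_comm]
  simp_rw [← Finset.sum_smul]
  congr 1
  refine Finset.sum_congr rfl fun w _ => ?_
  have := congrFun h2 w
  simp only [Matrix.vecMul, dotProduct, Pi.one_apply, one_mul] at this
  rw [this, one_smul]

/-- Accelerated gossip contracts the distance to consensus by `2 exp (-2 K √λ_W)`. -/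
lemma IsGossipMatrix.acceleratedGossip_contraction (hW : IsGossipMatrix G W)
    (hc : (communicationGraph W).Connected) (h : 0 < spectralGap W) (K : ℕ)
    (s : NetworkState V D) :
    ∑ v, ‖(acceleratedGossip W K s).cur v - nodeMean (acceleratedGossip W K s).cur‖ ^ 2
      ≤ 2 * Real.exp (-(2 * (K * Real.sqrt (spectralGap W))))
        * ∑ v, ‖s.cur v - nodeMean s.cur‖ ^ 2 := by
  have := hc.nonempty
  have hA : W.IsHermitian := by
    rw [Matrix.IsHermitian, Matrix.conjTranspose_eq_transpose_of_trivial]; exact hW.symm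
  set b := hA.eigenvectorBasis with hb
  set r := Real.sqrt (spectralGap W * (1 - spectralGap W / 4)) with hr
  have h1 := spectralGap_le_one h
  have hmulpos : 0 < spectralGap W * (1 - spectralGap W / 4) := mul_pos h (by linarith)
  have hr0 : 0 < r := Real.sqrt_pos.2 hmulpos
  have hr2 : r ^ 2 = spectralGap W * (1 - spectralGap W / 4) := Real.sq_sqrt hmulpos.le
  have hγ := accelerationParameter_mul h hr
  set γ := accelerationParameter W with hγdef
  have hγ1 : 0 ≤ γ - 1 := by
    have : r < 1 := by nlinarith
    nlinarith
  rw [← sum_norm_sum_smul_sq b,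
    ← sum_norm_sum_smul_sq b fun v => s.cur v - nodeMean s.cur, Finset.mul_sum]
  refine Finset.sum_le_sum fun j _ => ?_
  have hmul : W.mulVec (b j) = hA.eigenvalues j • ⇑(b j) := hA.mulVec_eigenvectorBasis j
  by_cases hj : hA.eigenvalues j = 1
  · rw [hj, one_smul] at hmul
    have hconst := hW.eq_of_mulVec_eq hc hmul
    rw [(sum_smul_sub_nodeMean _ _).1 hconst, (sum_smul_sub_nodeMean _ _).1 hconst]
    simp
  · have hvec : Matrix.vecMul (b j) W = hA.eigenvalues j • ⇑(b j) := by
      rw [← hmul, ← Matrix.vecMul_transpose, hW.symm.eq]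
    -- pairing with the constant vector, which is fixed by `W`
    have hsum : ∑ v, b j v = 0 := by
      have e1 : ∑ v, (W.mulVec (b j)) v = ∑ v, b j v := by
        simp only [Matrix.mulVec, dotProduct]
        rw [Finset.sum_comm]
        refine Finset.sum_congr rfl fun v _ => ?_
        simp_rw [← Finset.sum_mul, ← hW.symm.apply _ v, hW.row_sum, one_mul]
      rw [hmul] at e1
      simp only [Pi.smul_apply, smul_eq_mul, ← Finset.mul_sum] at e1
      have : (hA.eigenvalues j - 1) * ∑ v, b j v = 0 := by rw [sub_mul, e1]; ring
      exact (mul_eq_zero.1 this).resolve_left (sub_ne_zero.2 hj)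
    rw [(sum_smul_sub_nodeMean _ _).2 hsum, (sum_smul_sub_nodeMean _ _).2 hsum]
    have hcomp : ∑ v, b j v • (acceleratedGossip W K s).cur v
        = gossipPolynomial γ (hA.eigenvalues j) K • ∑ v, b j v • s.cur v := by
      simp_rw [acceleratedGossip_cur, Finset.smul_sum, smul_smul]
      rw [Finset.sum_comm]
      refine Finset.sum_congr rfl fun w _ => ?_
      rw [← Finset.sum_smul]
      congr 1
      exact congrFun (vecMul_gossipPolynomial γ hvec K) w
    rw [hcomp, norm_smul, mul_pow, Real.norm_eq_abs, sq_abs]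
    refine mul_le_mul_of_nonneg_right ?_ (sq_nonneg _)
    have hx := spectralGap_le_of_mem (hA.eigenvalues_mem_spectrum_real j) hj
    refine (gossipPolynomial_sq_le h h1 hr0 hr2 hγ (by linarith) K).trans ?_
    refine mul_le_mul_of_nonneg_left ?_ zero_le_two
    refine (pow_le_pow_left₀ hγ1 (accelerationRate_le_exp h h1 hr0 hr2 hγ) K).trans_eq ?_
    rw [← Real.exp_nat_mul]
    ring_nf

end Gossip

/-! ### Second moments of independent sums -/

section SecondMoment

variable {Ω : Type*} [MeasurableSpace Ω] {P : Measure Ω} {D : ℕ}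

lemma MeasureTheory.MemLp.integrable_norm_sq {E : Type*} [NormedAddCommGroup E] {S : Ω → E}
    (hS : MemLp S 2 P) : Integrable (fun a => ‖S a‖ ^ 2) P :=
  (memLp_two_iff_integrable_sq_norm hS.1).1 hS

lemma MeasureTheory.MemLp.integrable_norm_sub_sq {E : Type*} [NormedAddCommGroup E]
    [IsFiniteMeasure P] {S : Ω → E} (hS : MemLp S 2 P) (p : E) :
    Integrable (fun a => ‖S a - p‖ ^ 2) P :=
  (hS.sub (memLp_const p)).integrable_norm_sq

lemma MeasureTheory.MemLp.uniformMean {ι E : Type*} [Fintype ι] [NormedAddCommGroup E]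
    [InnerProductSpace ℝ E] {Z : ι → Ω → E} (hZ : ∀ i, MemLp (Z i) 2 P) :
    MemLp (fun a => _root_.uniformMean fun i => Z i a) 2 P :=
  (memLp_finsetSum Finset.univ fun i _ => hZ i).const_smul ((Fintype.card ι : ℝ)⁻¹)

lemma MeasureTheory.Integrable.uniformMean {ι : Type*} [Fintype ι] {Z : ι → Ω → ℝ}
    (hZ : ∀ i, Integrable (Z i) P) : Integrable (fun a => _root_.uniformMean fun i => Z i a) P :=
  (integrable_finsetSum Finset.univ fun i _ => hZ i).const_mul ((Fintype.card ι : ℝ)⁻¹)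

lemma integral_norm_const_add_sq {E : Type*} [NormedAddCommGroup E] [InnerProductSpace ℝ E]
    [CompleteSpace E] [IsProbabilityMeasure P] {S : Ω → E} (hS : MemLp S 2 P)
    (h0 : ∫ a, S a ∂P = 0) (c : E) :
    ∫ a, ‖c + S a‖ ^ 2 ∂P = ‖c‖ ^ 2 + ∫ a, ‖S a‖ ^ 2 ∂P := by
  have hint : Integrable S P := hS.integrable one_le_two
  simp_rw [norm_add_sq_real]
  rw [integral_add, integral_add, integral_const_mul, integral_inner hint, h0]
  · simp
  · exact integrable_const _
  · exact (hint.const_inner c).const_mul 2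
  · exact (integrable_const _).add ((hint.const_inner c).const_mul 2)
  · exact hS.integrable_norm_sq

lemma integral_norm_sum_sq_of_iIndepFun {ι E : Type*} [Fintype ι] [NormedAddCommGroup E]
    [InnerProductSpace ℝ E] [CompleteSpace E] [MeasurableSpace E] [BorelSpace E]
    {U : ι → Ω → E} (hU : ∀ i, MemLp (U i) 2 P) [IsProbabilityMeasure P]
    (h0 : ∀ i, ∫ a, U i a ∂P = 0) (hind : iIndepFun U P) :
    ∫ a, ‖∑ i, U i a‖ ^ 2 ∂P = ∑ i, ∫ a, ‖U i a‖ ^ 2 ∂P := by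
  classical
  have hint (i : ι) : Integrable (U i) P := (hU i).integrable one_le_two
  have hinn (i j : ι) : Integrable (fun a => inner ℝ (U i a) (U j a)) P := by
    by_cases hij : i = j
    · subst hij
      simpa only [real_inner_self_eq_norm_sq] using (hU i).integrable_norm_sq
    · exact (hind.indepFun hij).integrable_bilin (hint i) (hint j) (innerSL ℝ)
  have hval (i j : ι) (hij : i ≠ j) : ∫ a, inner ℝ (U i a) (U j a) ∂P = 0 := by
    have := (hind.indepFun hij).integral_bilin (hint i) (hint j) (innerSL ℝ)
    rw [h0, h0, map_zero] at this
    exact this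
  simp_rw [← real_inner_self_eq_norm_sq, sum_inner, inner_sum]
  rw [integral_finsetSum _ fun i _ => integrable_finsetSum _ fun j _ => hinn i j]
  refine Finset.sum_congr rfl fun i _ => ?_
  rw [integral_finsetSum _ fun j _ => hinn i j,
    Finset.sum_eq_single i (fun j _ hj => hval i j hj.symm) (by simp)]

/-- The mean of independent vectors has the expected bias, and a variance reduced by their number. -/
lemma integral_norm_uniformMean_sub_sq {ι E : Type*} [Fintype ι] [Nonempty ι]
    [NormedAddCommGroup E] [InnerProductSpace ℝ E] [CompleteSpace E] [MeasurableSpace E]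
    [BorelSpace E] [SecondCountableTopology E] {Z : ι → Ω → E} (hZ : ∀ i, MemLp (Z i) 2 P)
    [IsProbabilityMeasure P] (hind : iIndepFun Z P) (p : E) :
    ∫ a, ‖uniformMean (fun i => Z i a) - p‖ ^ 2 ∂P
      = ‖uniformMean (fun i => ∫ a, Z i a ∂P) - p‖ ^ 2 + (Fintype.card ι : ℝ)⁻¹ *
        uniformMean (fun i => ∫ a, ‖Z i a - ∫ b, Z i b ∂P‖ ^ 2 ∂P) := by
  have hU (i : ι) : MemLp (fun a => Z i a - ∫ b, Z i b ∂P) 2 P := (hZ i).sub (memLp_const _)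
  have h0 (i : ι) : ∫ a, (Z i a - ∫ b, Z i b ∂P) ∂P = 0 := by
    rw [integral_sub ((hZ i).integrable one_le_two) (integrable_const _)]
    simp
  have hindU : iIndepFun (fun i a => Z i a - ∫ b, Z i b ∂P) P :=
    hind.comp (fun i z => z - ∫ b, Z i b ∂P) fun i => measurable_id.sub_const _
  have hS : MemLp (fun a => ∑ i, (Z i a - ∫ b, Z i b ∂P)) 2 P := memLp_finsetSum _ fun i _ => hU i
  have hS0 : ∫ a, (Fintype.card ι : ℝ)⁻¹ • ∑ i, (Z i a - ∫ b, Z i b ∂P) ∂P = 0 := by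
    rw [integral_smul, integral_finsetSum _ fun i _ => (hU i).integrable one_le_two]
    simp [h0]
  have e (a : Ω) : uniformMean (fun i => Z i a) - p
      = (uniformMean (fun i => ∫ a, Z i a ∂P) - p)
        + (Fintype.card ι : ℝ)⁻¹ • ∑ i, (Z i a - ∫ b, Z i b ∂P) := by
    change _ = _ + uniformMean fun i => Z i a - ∫ b, Z i b ∂P
    rw [uniformMean_sub]
    abel
  simp_rw [e]
  rw [integral_norm_const_add_sq
    (S := fun a => (Fintype.card ι : ℝ)⁻¹ • ∑ i, (Z i a - ∫ b, Z i b ∂P)) (hS.const_smul _) hS0]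
  congr 1
  simp_rw [norm_smul, mul_pow]
  rw [integral_const_mul, integral_norm_sum_sq_of_iIndepFun hU h0 hindU,
    ← card_mul_uniformMean, Real.norm_of_nonneg (by positivity)]
  field_simp

end SecondMoment

/-! ### The law of the draws of one iteration -/

section Draws

variable {D : ℕ}

lemma integral_norm_sq_multivariateGaussian {c : ℝ} (hc : 0 ≤ c) :
    ∫ x, ‖x‖ ^ 2 ∂(multivariateGaussian 0 (c • (1 : Matrix (Fin D) (Fin D) ℝ))) = D * c := by
  set μ := multivariateGaussian 0 (c • (1 : Matrix (Fin D) (Fin D) ℝ))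
  have hS : (c • (1 : Matrix (Fin D) (Fin D) ℝ)).PosSemidef := Matrix.PosSemidef.one.smul hc
  have hL2 : MemLp id 2 μ := IsGaussian.memLp_two_id
  have hcoord (i : Fin D) : MemLp (fun x : EuclideanSpace ℝ (Fin D) => x i) 2 μ :=
    (EuclideanSpace.proj (𝕜 := ℝ) i).comp_memLp' hL2
  have hmean (i : Fin D) : ∫ x : EuclideanSpace ℝ (Fin D), x i ∂μ = 0 := by
    have h := (EuclideanSpace.proj (𝕜 := ℝ) i).integral_comp_comm
      (hL2.integrable one_le_two)
    simpa [μ] using h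
  simp_rw [EuclideanSpace.real_norm_sq_eq]
  rw [integral_finsetSum _ fun i _ => (hcoord i).integrable_sq]
  have hvar (i : Fin D) : ∫ x : EuclideanSpace ℝ (Fin D), x i ^ 2 ∂μ = c := by
    have h := variance_eval_multivariateGaussian (μ := 0) hS i
    rw [variance_of_integral_eq_zero (hcoord i).1.aemeasurable (hmean i)] at h
    simpa using h
  simp [hvar]

lemma integral_uniformOn_univ {m : ℕ} [NeZero m] {E : Type*} [NormedAddCommGroup E]
    [InnerProductSpace ℝ E] [CompleteSpace E] (f : Fin m → E) :
    ∫ i, f i ∂(uniformOn (Set.univ : Set (Fin m))) = uniformMean f := by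
  rw [integral_fintype Integrable.of_finite, uniformMean, Finset.smul_sum]
  refine Finset.sum_congr rfl fun i _ => ?_
  congr 1
  rw [Measure.real, uniformOn_univ, Measure.count_singleton]
  simp

/-- The law of the draw of one node at one iteration: a uniform index, and an independent centered
Gaussian vector with covariance `c • 1`. -/
def drawLaw (m D : ℕ) (c : ℝ) : Measure (Fin m × EuclideanSpace ℝ (Fin D)) :=
  (uniformOn (Set.univ : Set (Fin m))).prod
    (multivariateGaussian 0 (c • (1 : Matrix (Fin D) (Fin D) ℝ)))

instance {m : ℕ} [NeZero m] (c : ℝ) : IsProbabilityMeasure (drawLaw m D c) := by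
  unfold drawLaw; infer_instance

lemma memLp_perturbed {m : ℕ} (h : Fin m → EuclideanSpace ℝ (Fin D)) (c : ℝ) :
    MemLp (fun z => h z.1 + z.2) 2 (drawLaw m D c) :=
  ((MemLp.of_discrete (f := h)).comp_fst _).add (IsGaussian.memLp_two_id.comp_snd _)

section OneNode

variable {m : ℕ} [NeZero m] (h : Fin m → EuclideanSpace ℝ (Fin D)) (c : ℝ)

lemma integral_perturbed : ∫ z, (h z.1 + z.2) ∂(drawLaw m D c) = uniformMean h := by
  rw [drawLaw, integral_prod _ ((memLp_perturbed h c).integrable one_le_two),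
    ← integral_uniformOn_univ]
  refine integral_congr_ae (Filter.Eventually.of_forall fun i => ?_)
  have hid : Integrable id (multivariateGaussian 0 (c • (1 : Matrix (Fin D) (Fin D) ℝ))) :=
    IsGaussian.integrable_id
  have := integral_add (integrable_const (h i)) hid
  simpa using this

lemma integral_norm_perturbed_sq (hc : 0 ≤ c) :
    ∫ z, ‖h z.1 + z.2‖ ^ 2 ∂(drawLaw m D c) = uniformMean (fun i => ‖h i‖ ^ 2) + D * c := by
  rw [drawLaw, integral_prod _ (memLp_perturbed h c).integrable_norm_sq]
  have hid : MemLp id 2 (multivariateGaussian 0 (c • (1 : Matrix (Fin D) (Fin D) ℝ))) :=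
    IsGaussian.memLp_two_id
  have h1 (i : Fin m) := integral_norm_const_add_sq hid (by simp) (h i)
  simp only [id] at h1
  simp_rw [h1, integral_norm_sq_multivariateGaussian hc]
  rw [integral_uniformOn_univ (fun i => ‖h i‖ ^ 2 + D * c), uniformMean_add, uniformMean_const]

end OneNode

/-- The joint law of the independent draws of all nodes at one iteration. -/
def allDrawsLaw {V : Type*} [Fintype V] (m : V → ℕ) (D : ℕ) (c : ℝ) :
    Measure (∀ v, Fin (m v) × EuclideanSpace ℝ (Fin D)) :=
  Measure.pi fun v => drawLaw (m v) D c

instance {V : Type*} [Fintype V] {m : V → ℕ} [∀ v, NeZero (m v)] (c : ℝ) :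
    IsProbabilityMeasure (allDrawsLaw m D c) := by
  unfold allDrawsLaw; infer_instance

section AllNodes

variable {V : Type*} [Fintype V] {m : V → ℕ} [∀ v, NeZero (m v)]
  (h : ∀ v, Fin (m v) → EuclideanSpace ℝ (Fin D)) (c : ℝ)

lemma memLp_perturbed_eval (v : V) :
    MemLp (fun ξ : ∀ v, Fin (m v) × EuclideanSpace ℝ (Fin D) => h v (ξ v).1 + (ξ v).2) 2
      (allDrawsLaw m D c) :=
  (memLp_perturbed (h v) c).comp_measurePreserving
    (measurePreserving_eval (fun v => drawLaw (m v) D c) v)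

lemma integral_eval_pi {E : Type*} [NormedAddCommGroup E] [NormedSpace ℝ E] (v : V)
    {f : Fin (m v) × EuclideanSpace ℝ (Fin D) → E}
    (hf : AEStronglyMeasurable f (drawLaw (m v) D c)) :
    ∫ ξ, f (ξ v) ∂(allDrawsLaw m D c) = ∫ z, f z ∂(drawLaw (m v) D c) := by
  have hmp := measurePreserving_eval (fun v => drawLaw (m v) D c) v
  have := integral_map (f := f) hmp.measurable.aemeasurable (by rwa [hmp.map_eq])
  rw [hmp.map_eq] at this
  exact this.symm

/-- The mean squared distance of the perturbed values to a point. -/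
lemma integral_uniformMean_norm_sq (hc : 0 ≤ c) [Nonempty V] (p : EuclideanSpace ℝ (Fin D)) :
    ∫ ξ, uniformMean (fun v => ‖(h v (ξ v).1 + (ξ v).2) - p‖ ^ 2)
        ∂(allDrawsLaw m D c)
      = uniformMean (fun v => uniformMean fun i => ‖h v i - p‖ ^ 2) + D * c := by
  have hL (v : V) := memLp_perturbed_eval (fun v i => h v i - p) c v
  have e (ξ : ∀ v, Fin (m v) × EuclideanSpace ℝ (Fin D)) (v : V) :
      (h v (ξ v).1 + (ξ v).2) - p = (h v (ξ v).1 - p) + (ξ v).2 := by abel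
  simp_rw [e]
  unfold uniformMean
  rw [integral_smul, integral_finsetSum _ fun v _ => (hL v).integrable_norm_sq]
  have hv (v : V) : ∫ ξ, ‖(h v (ξ v).1 - p) + (ξ v).2‖ ^ 2
      ∂(allDrawsLaw m D c)
        = uniformMean (fun i => ‖h v i - p‖ ^ 2) + D * c := by
    rw [← integral_norm_perturbed_sq _ c hc]
    exact integral_eval_pi c v (f := fun z => ‖(h v z.1 - p) + z.2‖ ^ 2)
      (memLp_perturbed (fun i => h v i - p) c).integrable_norm_sq.1
  simp_rw [hv]
  change uniformMean (fun v => uniformMean (fun i => ‖h v i - p‖ ^ 2) + D * c) = _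
  rw [uniformMean_add, uniformMean_const]
  rfl

lemma integral_norm_nodeMean_sq (hc : 0 ≤ c) [Nonempty V] (p : EuclideanSpace ℝ (Fin D)) :
    ∫ ξ, ‖nodeMean (fun v => h v (ξ v).1 + (ξ v).2) - p‖ ^ 2
        ∂(allDrawsLaw m D c)
      = ‖uniformMean (fun v => uniformMean (h v)) - p‖ ^ 2
        + (Fintype.card V : ℝ)⁻¹ * (uniformMean (fun v => uniformMean fun i =>
          ‖h v i - uniformMean (h v)‖ ^ 2) + D * c) := by
  have hint (v : V) : ∫ ξ, (h v (ξ v).1 + (ξ v).2) ∂(allDrawsLaw m D c)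
      = uniformMean (h v) := by
    rw [← integral_perturbed (h v) c]
    exact integral_eval_pi c v (f := fun z => h v z.1 + z.2) (memLp_perturbed (h v) c).1
  have hind : iIndepFun (fun v (ξ : ∀ v, Fin (m v) × EuclideanSpace ℝ (Fin D)) =>
      h v (ξ v).1 + (ξ v).2) (allDrawsLaw m D c) :=
    iIndepFun_pi (X := fun v (z : Fin (m v) × EuclideanSpace ℝ (Fin D)) => h v z.1 + z.2)
      fun v => (memLp_perturbed (h v) c).1.aemeasurable
  have hsq (v : V) : ∫ ξ, ‖(h v (ξ v).1 + (ξ v).2) - uniformMean (h v)‖ ^ 2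
      ∂(allDrawsLaw m D c)
        = uniformMean (fun i => ‖h v i - uniformMean (h v)‖ ^ 2) + D * c := by
    simp_rw [add_sub_right_comm]
    rw [← integral_norm_perturbed_sq _ c hc]
    exact integral_eval_pi c v (f := fun z => ‖(h v z.1 - uniformMean (h v)) + z.2‖ ^ 2)
      (memLp_perturbed (fun i => h v i - uniformMean (h v)) c).integrable_norm_sq.1
  have key := integral_norm_uniformMean_sub_sq (fun v => memLp_perturbed_eval h c v) hind p
  simp_rw [hint, hsq] at key
  rw [uniformMean_add, uniformMean_const] at key
  exact key

end AllNodes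

end Draws

/-! ### One iteration, in expectation -/

section OneIteration

variable {V : Type*} [Fintype V] {D : ℕ} {m : V → ℕ} [∀ v, NeZero (m v)]

lemma norm_sub_sq_le_two {E : Type*} [NormedAddCommGroup E] [InnerProductSpace ℝ E] (x y z : E) :
    ‖x - z‖ ^ 2 ≤ 2 * ‖x - y‖ ^ 2 + 2 * ‖y - z‖ ^ 2 := by
  have h := parallelogram_law_with_norm ℝ (x - y) (y - z)
  rw [sub_add_sub_cancel] at h
  nlinarith [mul_self_nonneg ‖x - y - (y - z)‖]

lemma norm_sub_smul_sq_le {E : Type*} [NormedAddCommGroup E] [InnerProductSpace ℝ E] (ν : ℝ)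
    (x y z : E) :
    ‖x - ν • y‖ ^ 2 ≤ 3 / 2 * ‖x‖ ^ 2 + 6 * ν ^ 2 * (‖y - z‖ ^ 2 + ‖z‖ ^ 2) := by
  have h1 := norm_sub_sq_le_two y z 0
  rw [sub_zero, sub_zero] at h1
  have h2 : 0 ≤ ‖x + (2 * ν) • y‖ ^ 2 := sq_nonneg _
  rw [norm_add_sq_real, inner_smul_right, norm_smul, mul_pow, Real.norm_eq_abs, sq_abs] at h2
  rw [norm_sub_sq_real, inner_smul_right, norm_smul, mul_pow, Real.norm_eq_abs, sq_abs]
  nlinarith [mul_le_mul_of_nonneg_left h1 (sq_nonneg ν)]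

/-- Expected progress of the mean towards the minimizer `s`. Here `g v i` are the gradients at the
current points `θ v`, `gs v i` those at `s`, and `gap` is the sub-optimality of the mean. -/
lemma expected_mean_progress [Nonempty V] {θ : V → EuclideanSpace ℝ (Fin D)} {s : EuclideanSpace ℝ (Fin D)}
    {g gs : ∀ v, Fin (m v) → EuclideanSpace ℝ (Fin D)} {ρ : V → ℝ} {L ν σ gap Ξ : ℝ}
    (hL : 0 < L) (hν : 0 < ν) (hνL : ν * L ≤ 1 / 8) (hn : 2 ≤ Fintype.card V)
    (hin : gap - L / 2 * Ξ
      + 1 / (2 * L) * uniformMean (fun v => uniformMean fun i => ‖g v i - gs v i‖ ^ 2)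
        ≤ inner ℝ (nodeMean θ - s) (uniformMean fun v => uniformMean (g v)))
    (hzero : uniformMean (fun v => uniformMean (gs v)) = 0)
    (hρ : ∀ v, uniformMean (fun i => ‖gs v i - uniformMean (gs v)‖ ^ 2) ≤ ρ v ^ 2) :
    ‖uniformMean (fun v => uniformMean fun i => θ v - ν • g v i) - s‖ ^ 2
        + (Fintype.card V : ℝ)⁻¹ * (uniformMean (fun v => uniformMean fun i =>
          ‖(θ v - ν • g v i) - uniformMean (fun i => θ v - ν • g v i)‖ ^ 2) + D * (ν ^ 2 * σ ^ 2))
      ≤ ‖nodeMean θ - s‖ ^ 2 - 2 * ν * gap + ν * L * Ξ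
        - ν / (2 * L) * uniformMean (fun v => uniformMean fun i => ‖g v i - gs v i‖ ^ 2)
        + 2 * ν ^ 2 * (D * σ ^ 2 + uniformMean fun v => ρ v ^ 2) * (Fintype.card V : ℝ)⁻¹ := by
  set G := uniformMean (fun v => uniformMean fun i => ‖g v i - gs v i‖ ^ 2) with hG
  set gbar := uniformMean fun v => uniformMean (g v) with hgbar
  set N : ℝ := (Fintype.card V : ℝ)⁻¹ with hN
  set r2 := uniformMean fun v => ρ v ^ 2 with hr2
  have hG0 : 0 ≤ G := uniformMean_nonneg fun v => uniformMean_nonneg fun i => sq_nonneg _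
  have hN0 : 0 ≤ N := by positivity
  have hN2 : N ≤ 1 / 2 := by
    rw [hN, ← one_div]
    exact one_div_le_one_div_of_le two_pos (by exact_mod_cast hn)
  have hmean : uniformMean (fun v => uniformMean fun i => θ v - ν • g v i)
      = nodeMean θ - ν • gbar := by
    simp_rw [uniformMean_sub, uniformMean_const, uniformMean_smul]
    rfl
  have hgsq : ‖gbar‖ ^ 2 ≤ G := by
    have : gbar = uniformMean (fun v => uniformMean fun i => g v i - gs v i) := by
      simp_rw [uniformMean_sub, hzero, sub_zero]
      rfl
    rw [this]
    exact (norm_uniformMean_sq_le _).trans (uniformMean_mono fun v => norm_uniformMean_sq_le _)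
  have hvar : uniformMean (fun v => uniformMean fun i =>
      ‖(θ v - ν • g v i) - uniformMean (fun i => θ v - ν • g v i)‖ ^ 2)
        ≤ ν ^ 2 * (2 * G + 2 * r2) := by
    have e (v : V) (i : Fin (m v)) :
        ‖(θ v - ν • g v i) - uniformMean (fun i => θ v - ν • g v i)‖ ^ 2
          = ν ^ 2 * ‖g v i - uniformMean (g v)‖ ^ 2 := by
      rw [uniformMean_sub, uniformMean_const, uniformMean_smul]
      rw [show θ v - ν • g v i - (θ v - ν • uniformMean fun i => g v i)
        = -(ν • (g v i - uniformMean (g v))) by rw [smul_sub]; abel]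
      rw [norm_neg, norm_smul, mul_pow, Real.norm_eq_abs, sq_abs]
    simp_rw [e, uniformMean_mul]
    refine mul_le_mul_of_nonneg_left ?_ (sq_nonneg ν)
    rw [hG, hr2, ← uniformMean_mul, ← uniformMean_mul, ← uniformMean_add]
    refine uniformMean_mono fun v => ?_
    refine (uniformMean_norm_sub_mean_sq_le (g v) (uniformMean (gs v))).trans ?_
    refine (uniformMean_mono fun i => norm_sub_sq_le_two (g v i) (gs v i) _).trans ?_
    rw [uniformMean_add, uniformMean_mul, uniformMean_mul]
    linarith [hρ v]
  rw [hmean, show nodeMean θ - ν • gbar - s = (nodeMean θ - s) - ν • gbar by abel,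
    norm_sub_sq_real, inner_smul_right, norm_smul, mul_pow, Real.norm_eq_abs, sq_abs]
  have h1 := mul_le_mul_of_nonneg_left hin hν.le
  have h2 := mul_le_mul_of_nonneg_left hgsq (sq_nonneg ν)
  have h3 := mul_le_mul_of_nonneg_left hvar hN0
  have h4 : N * (ν ^ 2 * (2 * G)) ≤ 1 / 2 * (ν ^ 2 * (2 * G)) :=
    mul_le_mul_of_nonneg_right hN2 (by positivity)
  have h5 : 2 * ν ^ 2 * G ≤ ν / (2 * L) * G := by
    refine mul_le_mul_of_nonneg_right ?_ hG0
    rw [le_div_iff₀ (by positivity)]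
    nlinarith
  have h6 : 0 ≤ N * (D * (ν ^ 2 * σ ^ 2)) := by positivity
  have h7 : ν * (1 / (2 * L) * G) = ν / (2 * L) * G := by ring
  nlinarith

/-- Expected distance to the previous mean after a perturbed gradient step. -/
lemma expected_consensus_le {θ : V → EuclideanSpace ℝ (Fin D)}
    {g gs : ∀ v, Fin (m v) → EuclideanSpace ℝ (Fin D)} {ρ ζ : V → ℝ} {ν σ : ℝ}
    (hζ : ∀ v, ‖uniformMean (gs v)‖ ^ 2 ≤ ζ v ^ 2)
    (hρ : ∀ v, uniformMean (fun i => ‖gs v i - uniformMean (gs v)‖ ^ 2) ≤ ρ v ^ 2) :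
    uniformMean (fun v => uniformMean fun i => ‖(θ v - ν • g v i) - nodeMean θ‖ ^ 2)
        + D * (ν ^ 2 * σ ^ 2)
      ≤ 3 / 2 * uniformMean (fun v => ‖θ v - nodeMean θ‖ ^ 2)
        + 6 * ν ^ 2 * uniformMean (fun v => uniformMean fun i => ‖g v i - gs v i‖ ^ 2)
        + 6 * ν ^ 2 * (uniformMean (fun v => ζ v ^ 2)
          + (D * σ ^ 2 + uniformMean fun v => ρ v ^ 2)) := by
  have h1 : uniformMean (fun v => uniformMean fun i => ‖(θ v - ν • g v i) - nodeMean θ‖ ^ 2)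
      ≤ uniformMean fun v => (3 / 2 * ‖θ v - nodeMean θ‖ ^ 2
        + 6 * ν ^ 2 * uniformMean (fun i => ‖g v i - gs v i‖ ^ 2))
        + 6 * ν ^ 2 * (ζ v ^ 2 + ρ v ^ 2) := by
    refine uniformMean_mono fun v => ?_
    have h2 : uniformMean (fun i => ‖gs v i‖ ^ 2) ≤ ζ v ^ 2 + ρ v ^ 2 := by
      have := uniformMean_norm_sub_sq (gs v) 0
      simp only [sub_zero] at this
      rw [this]
      linarith [hζ v, hρ v]
    have h3 (i : Fin (m v)) : ‖(θ v - ν • g v i) - nodeMean θ‖ ^ 2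
        ≤ 3 / 2 * ‖θ v - nodeMean θ‖ ^ 2 + 6 * ν ^ 2 * (‖g v i - gs v i‖ ^ 2 + ‖gs v i‖ ^ 2) := by
      rw [sub_right_comm]
      exact norm_sub_smul_sq_le ν _ _ _
    refine (uniformMean_mono h3).trans ?_
    rw [uniformMean_add, uniformMean_const, uniformMean_mul, uniformMean_add]
    nlinarith [mul_le_mul_of_nonneg_left h2 (sq_nonneg ν)]
  rw [uniformMean_add, uniformMean_add, uniformMean_mul, uniformMean_mul, uniformMean_mul,
    uniformMean_add] at h1
  have h4 : 0 ≤ (D : ℝ) * (ν ^ 2 * σ ^ 2) := by positivity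
  nlinarith

end OneIteration

/-! ### The perturbed step and the Lyapunov function -/

section PerturbedStep

variable {V : Type*} {D : ℕ} {m : V → ℕ}

/-- The values of the nodes before gossip: a gradient step with the sampled gradient, plus noise. -/
def perturbedStep (ν : ℝ)
    (g : ∀ v, Fin (m v) → EuclideanSpace ℝ (Fin D) → EuclideanSpace ℝ (Fin D))
    (θ : V → EuclideanSpace ℝ (Fin D)) (ξ : ∀ v, Fin (m v) × EuclideanSpace ℝ (Fin D)) :
    V → EuclideanSpace ℝ (Fin D) :=
  fun v => (θ v - ν • g v (ξ v).1 (θ v)) + (ξ v).2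

lemma measurable_perturbedStep {ν : ℝ}
    {g : ∀ v, Fin (m v) → EuclideanSpace ℝ (Fin D) → EuclideanSpace ℝ (Fin D)}
    (hg : ∀ v i, Continuous (g v i)) :
    Measurable fun z : (V → EuclideanSpace ℝ (Fin D)) ×
      (∀ v, Fin (m v) × EuclideanSpace ℝ (Fin D)) => perturbedStep ν g z.1 z.2 := by
  refine measurable_pi_lambda _ fun v => ?_
  have h1 : Measurable fun p : Fin (m v) × EuclideanSpace ℝ (Fin D) => g v p.1 p.2 :=
    measurable_from_prod_countable_right fun i => (hg v i).measurable
  have h2 : Measurable fun z : (V → EuclideanSpace ℝ (Fin D)) ×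
      (∀ v, Fin (m v) × EuclideanSpace ℝ (Fin D)) => g v (z.2 v).1 (z.1 v) :=
    h1.comp (f := fun z : (V → EuclideanSpace ℝ (Fin D)) ×
      (∀ v, Fin (m v) × EuclideanSpace ℝ (Fin D)) => ((z.2 v).1, z.1 v)) (by fun_prop)
  unfold perturbedStep
  fun_prop

end PerturbedStep


section Lyapunov

variable {V : Type*} [Fintype V] {D : ℕ} {m : V → ℕ}

/-- The Lyapunov function `‖θ̄ - s‖² + a · (1/n) ∑ ‖θ_v - θ̄‖²`. -/
def lyapunov (a : ℝ) (s : EuclideanSpace ℝ (Fin D)) (θ : V → EuclideanSpace ℝ (Fin D)) : ℝ :=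
  ‖nodeMean θ - s‖ ^ 2 + a * uniformMean fun v => ‖θ v - nodeMean θ‖ ^ 2

lemma lyapunov_nonneg {a : ℝ} (ha : 0 ≤ a) (s : EuclideanSpace ℝ (Fin D))
    (θ : V → EuclideanSpace ℝ (Fin D)) : 0 ≤ lyapunov a s θ :=
  add_nonneg (sq_nonneg _) (mul_nonneg ha (uniformMean_nonneg fun _ => sq_nonneg _))

lemma lyapunov_le [Nonempty V] {a : ℝ} (ha : a ≤ 1) (s : EuclideanSpace ℝ (Fin D))
    (θ : V → EuclideanSpace ℝ (Fin D)) :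
    lyapunov a s θ ≤ uniformMean fun v => ‖θ v - s‖ ^ 2 := by
  rw [uniformMean_norm_sub_sq, lyapunov, add_comm]
  have h := uniformMean_nonneg fun v => sq_nonneg ‖θ v - uniformMean θ‖
  have : nodeMean θ = uniformMean θ := rfl
  rw [this]
  nlinarith

lemma continuous_nodeMean :
    Continuous fun θ : V → EuclideanSpace ℝ (Fin D) => nodeMean θ := by
  unfold nodeMean
  fun_prop

lemma measurable_lyapunov (a : ℝ) (s : EuclideanSpace ℝ (Fin D)) :
    Measurable (lyapunov a s : (V → EuclideanSpace ℝ (Fin D)) → ℝ) := by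
  have := continuous_nodeMean (V := V) (D := D)
  refine Continuous.measurable ?_
  unfold lyapunov uniformMean
  fun_prop

variable [DecidableEq V]

/-- One full iteration, as a function of the current values and of the draws. -/
def iteration (ν : ℝ)
    (g : ∀ v, Fin (m v) → EuclideanSpace ℝ (Fin D) → EuclideanSpace ℝ (Fin D))
    (W : Matrix V V ℝ) (K : ℕ) (θ : V → EuclideanSpace ℝ (Fin D))
    (ξ : ∀ v, Fin (m v) × EuclideanSpace ℝ (Fin D)) : V → EuclideanSpace ℝ (Fin D) :=
  fun v => ∑ w, gossipPolynomial (accelerationParameter W) W K v w • perturbedStep ν g θ ξ w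

lemma measurable_iteration {ν : ℝ}
    {g : ∀ v, Fin (m v) → EuclideanSpace ℝ (Fin D) → EuclideanSpace ℝ (Fin D)}
    (hg : ∀ v i, Continuous (g v i)) (W : Matrix V V ℝ) (K : ℕ) :
    Measurable fun z : (V → EuclideanSpace ℝ (Fin D)) ×
      (∀ v, Fin (m v) × EuclideanSpace ℝ (Fin D)) => iteration ν g W K z.1 z.2 := by
  have h := measurable_perturbedStep (ν := ν) hg
  refine measurable_pi_lambda _ fun v => ?_
  unfold iteration
  fun_prop

lemma measurable_lyapunov_iteration {ν : ℝ}
    {g : ∀ v, Fin (m v) → EuclideanSpace ℝ (Fin D) → EuclideanSpace ℝ (Fin D)}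
    (hg : ∀ v i, Continuous (g v i)) (W : Matrix V V ℝ) (K : ℕ) (a : ℝ)
    (s : EuclideanSpace ℝ (Fin D)) :
    Measurable fun z : (V → EuclideanSpace ℝ (Fin D)) ×
      (∀ v, Fin (m v) × EuclideanSpace ℝ (Fin D)) => lyapunov a s (iteration ν g W K z.1 z.2) :=
  (measurable_lyapunov a s).comp (measurable_iteration hg W K)

lemma measurable_lyapunov_iteration_right {ν : ℝ}
    {g : ∀ v, Fin (m v) → EuclideanSpace ℝ (Fin D) → EuclideanSpace ℝ (Fin D)}
    (hg : ∀ v i, Continuous (g v i)) (W : Matrix V V ℝ) (K : ℕ) (a : ℝ)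
    (s : EuclideanSpace ℝ (Fin D)) (θ : V → EuclideanSpace ℝ (Fin D)) :
    Measurable fun ξ : ∀ v, Fin (m v) × EuclideanSpace ℝ (Fin D) =>
      lyapunov a s (iteration ν g W K θ ξ) := by
  have h := (measurable_lyapunov_iteration (ν := ν) hg W K a s).comp
    (measurable_prodMk_left (x := θ))
  simp only [Function.comp_def] at h
  exact h

end Lyapunov

/-! ### Contraction of the Lyapunov function -/

section

variable {V : Type*} [Fintype V] [Nonempty V] [DecidableEq V] {D : ℕ} {m : V → ℕ}
  [∀ v, NeZero (m v)] {g : ∀ v, Fin (m v) → EuclideanSpace ℝ (Fin D) → EuclideanSpace ℝ (Fin D)}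
  {s : EuclideanSpace ℝ (Fin D)} {G : SimpleGraph V} {W : Matrix V V ℝ}

/-- Expectation of the Lyapunov function after one iteration, in terms of the perturbed values: gossip
preserves the mean, and multiplies the squared deviations from it by at most `α`. -/
lemma expected_lyapunov_iteration_le (hg : ∀ v i, Continuous (g v i))
    (hW : IsGossipMatrix G W) (hc : (communicationGraph W).Connected) (hgap : 0 < spectralGap W)
    {K : ℕ} {ν α a c : ℝ} (ha : 0 ≤ a) (hcov : 0 ≤ c)
    (hα : 2 * Real.exp (-(2 * (K * Real.sqrt (spectralGap W)))) ≤ α)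
    (θ : V → EuclideanSpace ℝ (Fin D)) :
    Integrable (fun ξ => lyapunov a s (iteration ν g W K θ ξ))
        (allDrawsLaw m D c) ∧
      ∫ ξ, lyapunov a s (iteration ν g W K θ ξ) ∂(allDrawsLaw m D c)
      ≤ (‖uniformMean (fun v => uniformMean fun i => θ v - ν • g v i (θ v)) - s‖ ^ 2
          + (Fintype.card V : ℝ)⁻¹ * (uniformMean (fun v => uniformMean fun i =>
            ‖(θ v - ν • g v i (θ v)) - uniformMean (fun i => θ v - ν • g v i (θ v))‖ ^ 2)
            + D * c))
        + a * α * (uniformMean (fun v => uniformMean fun i =>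
            ‖(θ v - ν • g v i (θ v)) - nodeMean θ‖ ^ 2) + D * c) := by
  have hα0 : 0 ≤ α := le_trans (by positivity) hα
  have hL2 (v : V) : MemLp (fun ξ => perturbedStep ν g θ ξ v) 2
      (allDrawsLaw m D c) :=
    memLp_perturbed_eval (fun v i => θ v - ν • g v i (θ v)) c v
  have hint1 : Integrable (fun ξ =>
      ‖nodeMean (perturbedStep ν g θ ξ) - s‖ ^ 2) (allDrawsLaw m D c) :=
    (MemLp.uniformMean hL2).integrable_norm_sub_sq s
  have hint2 : Integrable (fun ξ => uniformMean fun v =>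
      ‖perturbedStep ν g θ ξ v - nodeMean θ‖ ^ 2) (allDrawsLaw m D c) :=
    Integrable.uniformMean fun v => (hL2 v).integrable_norm_sub_sq (nodeMean θ)
  have hle (ξ : ∀ v, Fin (m v) × EuclideanSpace ℝ (Fin D)) :
      lyapunov a s (iteration ν g W K θ ξ)
        ≤ ‖nodeMean (perturbedStep ν g θ ξ) - s‖ ^ 2
          + a * α * uniformMean fun v =>
            ‖perturbedStep ν g θ ξ v - nodeMean θ‖ ^ 2 := by
    generalize hy : perturbedStep ν g θ ξ = y
    have hcur : iteration ν g W K θ ξ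
        = (acceleratedGossip W K ⟨θ, y, 0, 0⟩).cur := by
      funext v
      rw [acceleratedGossip_cur, ← hy]
      rfl
    have hcontr := hW.acceleratedGossip_contraction hc hgap K ⟨θ, y, 0, 0⟩
    have h1 : ∑ v, ‖y v - nodeMean y‖ ^ 2
        ≤ Fintype.card V * uniformMean fun v => ‖y v - nodeMean θ‖ ^ 2 := by
      have := uniformMean_norm_sub_mean_sq_le y (nodeMean θ)
      rw [← card_mul_uniformMean]
      exact mul_le_mul_of_nonneg_left this (by positivity)
    rw [hcur, lyapunov, mul_assoc a]
    refine add_le_add (le_of_eq ?_) (mul_le_mul_of_nonneg_left ?_ ha)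
    · rw [hW.nodeMean_acceleratedGossip]
    · have hn : (0 : ℝ) < Fintype.card V := by positivity
      refine le_of_mul_le_mul_left ?_ hn
      rw [card_mul_uniformMean]
      calc _ ≤ _ := hcontr
        _ ≤ α * (Fintype.card V * uniformMean fun v => ‖y v - nodeMean θ‖ ^ 2) :=
          mul_le_mul hα h1 (Finset.sum_nonneg fun _ _ => sq_nonneg _) hα0
        _ = _ := by ring
  have hmeas : Measurable fun ξ => lyapunov a s
      (iteration ν g W K θ ξ) :=
    measurable_lyapunov_iteration_right hg W K a s θ
  have hint := hint1.add (hint2.const_mul (a * α))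
  have hLy : Integrable (fun ξ => lyapunov a s
      (iteration ν g W K θ ξ)) (allDrawsLaw m D c) := by
    refine hint.mono' hmeas.aestronglyMeasurable (Filter.Eventually.of_forall fun ξ => ?_)
    rw [Real.norm_of_nonneg (lyapunov_nonneg ha _ _)]
    exact hle ξ
  refine ⟨hLy, (integral_mono hLy hint hle).trans_eq ?_⟩
  simp only [Pi.add_apply]
  rw [integral_add hint1 (hint2.const_mul _), integral_const_mul]
  congr 1
  · exact integral_norm_nodeMean_sq (fun v i => θ v - ν • g v i (θ v)) c hcov s
  · congr 1
    exact integral_uniformMean_norm_sq (fun v i => θ v - ν • g v i (θ v)) c hcov (nodeMean θ)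

end

/-- The double average `(1/n) ∑_v (1/m_v) ∑_i f v i` of a family of functions. -/
def averageObjective {V : Type*} [Fintype V] {D : ℕ} {m : V → ℕ}
    (f : ∀ v, Fin (m v) → EuclideanSpace ℝ (Fin D) → ℝ) (θ : EuclideanSpace ℝ (Fin D)) : ℝ :=
  uniformMean fun v => uniformMean fun i => f v i θ

/-- The assumptions on the losses `f v i`: convexity and `L`-smoothness, `μ`-strong convexity of
their average, with minimizer `s`, and the bounds `ζ v` on the local gradients and `ρ v` on the
sampling noise at the minimizer. As the gradient of the average vanishes at `s`, heterogeneity is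
the size of the local gradient. -/
structure IsRegularProblem {V : Type*} [Fintype V] {D : ℕ} {m : V → ℕ}
    (f : ∀ v, Fin (m v) → EuclideanSpace ℝ (Fin D) → ℝ) (L μ : ℝ) (s : EuclideanSpace ℝ (Fin D))
    (ζ ρ : V → ℝ) : Prop where
  convex : ∀ v i, ConvexOn ℝ Set.univ (f v i)
  smooth : ∀ v i, IsLSmooth L (f v i)
  strong : StrongConvexOn Set.univ μ (averageObjective f)
  isMin : ∀ θ, averageObjective f s ≤ averageObjective f θ
  heterogeneity : ∀ v, ‖uniformMean fun i => ∇ (f v i) s‖ ^ 2 ≤ ζ v ^ 2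
  samplingNoise : ∀ v, uniformMean (fun i => ‖∇ (f v i) s - uniformMean fun j => ∇ (f v j) s‖ ^ 2)
    ≤ ρ v ^ 2

namespace IsRegularProblem

variable {V : Type*} [Fintype V] {D : ℕ} {m : V → ℕ}
  {f : ∀ v, Fin (m v) → EuclideanSpace ℝ (Fin D) → ℝ} {L μ : ℝ} {s : EuclideanSpace ℝ (Fin D)}
  {ζ ρ : V → ℝ}

lemma gap_nonneg (hf : IsRegularProblem f L μ s ζ ρ) (θ : EuclideanSpace ℝ (Fin D)) :
    0 ≤ averageObjective f θ - averageObjective f s := sub_nonneg.2 (hf.isMin θ)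

lemma le_gap (hf : IsRegularProblem f L μ s ζ ρ) (θ : EuclideanSpace ℝ (Fin D)) :
    μ / 2 * ‖θ - s‖ ^ 2 ≤ averageObjective f θ - averageObjective f s :=
  hf.strong.quadratic_growth hf.isMin θ

lemma mean_gradient_eq_zero (hf : IsRegularProblem f L μ s ζ ρ) :
    uniformMean (fun v => uniformMean fun i => ∇ (f v i) s) = 0 := by
  rw [← gradient_eq_zero_of_forall_le hf.isMin]
  unfold averageObjective
  rw [gradient_uniformMean fun v => differentiable_uniformMean fun i => (hf.smooth v i).1]
  simp_rw [gradient_uniformMean fun i => (hf.smooth _ i).1]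

variable [∀ v, NeZero (m v)]

lemma inner_mean_gradient_ge (hf : IsRegularProblem f L μ s ζ ρ) (hL : 0 < L)
    (θ : V → EuclideanSpace ℝ (Fin D)) :
    (averageObjective f (nodeMean θ) - averageObjective f s)
      - L / 2 * uniformMean (fun v => ‖θ v - nodeMean θ‖ ^ 2)
      + 1 / (2 * L) * uniformMean
          (fun v => uniformMean fun i => ‖∇ (f v i) (θ v) - ∇ (f v i) s‖ ^ 2)
      ≤ inner ℝ (nodeMean θ - s)
          (uniformMean fun v => uniformMean fun i => ∇ (f v i) (θ v)) := by
  simp_rw [inner_uniformMean]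
  have h := uniformMean_mono fun v => uniformMean_mono fun i =>
    (hf.smooth v i).inner_gradient_ge hL (hf.convex v i) (nodeMean θ) s (θ v)
  simp_rw [uniformMean_add, uniformMean_sub, uniformMean_mul, uniformMean_const] at h
  exact h

variable [Nonempty V]

lemma smooth_averageObjective (hf : IsRegularProblem f L μ s ζ ρ) :
    IsLSmooth L (averageObjective f) :=
  IsLSmooth.uniformMean fun v => IsLSmooth.uniformMean fun i => hf.smooth v i

lemma continuous_averageObjective (hf : IsRegularProblem f L μ s ζ ρ) :
    Continuous (averageObjective f) :=
  hf.smooth_averageObjective.1.continuous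

lemma gap_le (hf : IsRegularProblem f L μ s ζ ρ) (θ : EuclideanSpace ℝ (Fin D)) :
    averageObjective f θ - averageObjective f s ≤ L / 2 * ‖θ - s‖ ^ 2 := by
  have h := hf.smooth_averageObjective.le_quadratic s θ
  rw [gradient_eq_zero_of_forall_le hf.isMin, inner_zero_left] at h
  linarith

lemma strong_le_smooth (hf : IsRegularProblem f L μ s ζ ρ) (hD : 0 < D) : μ ≤ L := by
  set θ := s + EuclideanSpace.single (⟨0, hD⟩ : Fin D) (1 : ℝ)
  have hθ : ‖θ - s‖ = 1 := by simp [θ]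
  have h1 := hf.gap_le θ
  have h2 := hf.le_gap θ
  rw [hθ] at h1 h2
  linarith

variable [DecidableEq V] {G : SimpleGraph V} {W : Matrix V V ℝ}

/-- One iteration contracts the Lyapunov function in expectation, up to the sub-optimality of the
mean and a noise term divided by the number of nodes. The factor `α` by which gossip contracts the
deviations from the mean is so small that the heterogeneity enters only through that noise term. -/
lemma expected_lyapunov_iteration (hf : IsRegularProblem f L μ s ζ ρ) (hD : 0 < D) (hμ : 0 < μ)
    (hW : IsGossipMatrix G W) (hc : (communicationGraph W).Connected) (hgap : 0 < spectralGap W)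
    {K : ℕ} {ν σ α B : ℝ} (hν : 0 < ν) (hνL : ν * L ≤ 1 / 8)
    (hB : B = D * σ ^ 2 + uniformMean fun v => ρ v ^ 2)
    (hα : 2 * Real.exp (-(2 * (K * Real.sqrt (spectralGap W)))) ≤ α) (hα2 : α ≤ 1 / 2)
    (hαB : α * (uniformMean (fun v => ζ v ^ 2) + B) ≤ 4 * B * (Fintype.card V : ℝ)⁻¹)
    (θ : V → EuclideanSpace ℝ (Fin D)) :
    Integrable (fun ξ => lyapunov (8 * (ν * L)) s
        (iteration ν (fun v i => ∇ (f v i)) W K θ ξ)) (allDrawsLaw m D (ν ^ 2 * σ ^ 2)) ∧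
      ∫ ξ, lyapunov (8 * (ν * L)) s (iteration ν (fun v i => ∇ (f v i)) W K θ ξ)
        ∂(allDrawsLaw m D (ν ^ 2 * σ ^ 2))
      ≤ (1 - ν * μ / 2) * lyapunov (8 * (ν * L)) s θ
        - ν * (averageObjective f (nodeMean θ) - averageObjective f s)
        + 26 * ν ^ 2 * B * (Fintype.card V : ℝ)⁻¹ := by
  have hμL := hf.strong_le_smooth hD
  have hL : 0 < L := hμ.trans_le hμL
  have hα0 : 0 ≤ α := le_trans (by positivity) hα
  have hn2 := hW.two_le_card hgap
  have hνL0 : 0 ≤ ν * L := by positivity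
  obtain ⟨hint, hle⟩ := _root_.expected_lyapunov_iteration_le (s := s) (ν := ν) (a := 8 * (ν * L))
    (c := ν ^ 2 * σ ^ 2) (fun v i => (hf.smooth v i).continuous_gradient) hW hc hgap (by positivity) (by positivity) hα θ
  refine ⟨hint, hle.trans ?_⟩
  have p1 := expected_mean_progress (θ := θ) (s := s) (g := fun v i => ∇ (f v i) (θ v))
    (gs := fun v i => ∇ (f v i) s) (ρ := ρ) (σ := σ) hL hν hνL hn2
    (hf.inner_mean_gradient_ge hL θ) hf.mean_gradient_eq_zero hf.samplingNoise
  have p2 := expected_consensus_le (θ := θ) (g := fun v i => ∇ (f v i) (θ v))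
    (gs := fun v i => ∇ (f v i) s) (ζ := ζ) (ρ := ρ) (ν := ν) (σ := σ)
    hf.heterogeneity hf.samplingNoise
  rw [← hB] at p1 p2
  have hgrowth := hf.le_gap (nodeMean θ)
  have hΞ0 : 0 ≤ uniformMean fun v => ‖θ v - nodeMean θ‖ ^ 2 :=
    uniformMean_nonneg fun v => sq_nonneg _
  have hG0 : 0 ≤ uniformMean
      (fun v => uniformMean fun i => ‖∇ (f v i) (θ v) - ∇ (f v i) s‖ ^ 2) :=
    uniformMean_nonneg fun v => uniformMean_nonneg fun i => sq_nonneg _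
  have hB0 : 0 ≤ B := by
    rw [hB]
    exact add_nonneg (by positivity) (uniformMean_nonneg fun v => sq_nonneg _)
  refine (add_le_add_left p1 _).trans ?_
  unfold lyapunov
  generalize uniformMean (fun v => ‖θ v - nodeMean θ‖ ^ 2) = Ξ at *
  generalize uniformMean
    (fun v => uniformMean fun i => ‖∇ (f v i) (θ v) - ∇ (f v i) s‖ ^ 2) = Γ at *
  generalize averageObjective f (nodeMean θ) - averageObjective f s = gap at *
  generalize ‖nodeMean θ - s‖ ^ 2 = r at *
  generalize uniformMean (fun v => ζ v ^ 2) = Z at *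
  have hN0 : 0 ≤ (Fintype.card V : ℝ)⁻¹ := by positivity
  generalize (Fintype.card V : ℝ)⁻¹ = N at *
  generalize uniformMean (fun v => uniformMean fun i =>
    ‖(θ v - ν • ∇ (f v i) (θ v)) - nodeMean θ‖ ^ 2) + D * (ν ^ 2 * σ ^ 2) = S2 at *
  have q2 : α * S2 ≤ 3 / 4 * Ξ + 3 * ν ^ 2 * Γ + 24 * ν ^ 2 * B * N := by
    have t1 := mul_le_mul_of_nonneg_left p2 hα0
    have t2 := mul_le_mul_of_nonneg_left hαB (show 0 ≤ 6 * ν ^ 2 by positivity)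
    have t3 : α * (3 / 2 * Ξ + 6 * ν ^ 2 * Γ) ≤ 1 / 2 * (3 / 2 * Ξ + 6 * ν ^ 2 * Γ) :=
      mul_le_mul_of_nonneg_right hα2 (by positivity)
    calc α * S2 ≤ _ := t1
      _ = α * (3 / 2 * Ξ + 6 * ν ^ 2 * Γ) + 6 * ν ^ 2 * (α * (Z + B)) := by ring
      _ ≤ 1 / 2 * (3 / 2 * Ξ + 6 * ν ^ 2 * Γ) + 6 * ν ^ 2 * (4 * B * N) := add_le_add t3 t2
      _ = _ := by ring
  have q3 := mul_le_mul_of_nonneg_left q2 (show 0 ≤ 8 * (ν * L) by positivity)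
  have q4 : 24 * ν ^ 3 * L * Γ ≤ ν / (2 * L) * Γ := by
    refine mul_le_mul_of_nonneg_right ?_ hG0
    rw [le_div_iff₀ (by positivity)]
    have : (ν * L) ^ 2 ≤ (1 / 8) ^ 2 := pow_le_pow_left₀ hνL0 hνL 2
    nlinarith
  have q5 : 192 * (ν * L) * (ν ^ 2 * B * N) ≤ 24 * (ν ^ 2 * B * N) :=
    mul_le_mul_of_nonneg_right (by linarith) (by positivity)
  have q6 : ν * μ / 2 * (8 * (ν * L) * Ξ) ≤ 1 / 8 * (8 * (ν * L) * Ξ) := by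
    refine mul_le_mul_of_nonneg_right ?_ (by positivity)
    have := mul_le_mul_of_nonneg_left hμL hν.le
    linarith
  have q7 := mul_le_mul_of_nonneg_left hgrowth hν.le
  have q8 : 8 * (ν * L) * (3 / 4 * Ξ + 3 * ν ^ 2 * Γ + 24 * ν ^ 2 * B * N)
      = 6 * (ν * L) * Ξ + 24 * ν ^ 3 * L * Γ + 192 * (ν * L) * (ν ^ 2 * B * N) := by ring
  rw [q8] at q3
  have q9 : 8 * (ν * L) * α * S2 = 8 * (ν * L) * (α * S2) := by ring
  rw [q9]
  have q10 : (1 - ν * μ / 2) * (r + 8 * (ν * L) * Ξ) - ν * gap + 26 * ν ^ 2 * B * N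
      = r + 8 * (ν * L) * Ξ - ν * (μ / 2 * r) - ν * μ / 2 * (8 * (ν * L) * Ξ) - ν * gap
        + 26 * (ν ^ 2 * B * N) := by ring
  rw [q10]
  linarith

end IsRegularProblem

/-! ### Averaging over independent draws -/

section Independence

variable {Ω S T : Type*} [MeasurableSpace Ω] [MeasurableSpace S] [MeasurableSpace T]
  {P : Measure Ω} [IsProbabilityMeasure P]

/-- An upper bound on the mean of `H (x, ξ)` for each fixed `x` can be averaged over a random point
`X` that is independent of `ξ`. -/
lemma integral_le_of_indepFun {X : Ω → S} {ξ : Ω → T} (hX : Measurable X) (hξ : Measurable ξ)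
    (hind : IndepFun X ξ P) {H : S × T → ℝ} (hH : Measurable H) (hH0 : ∀ z, 0 ≤ H z) {F : S → ℝ}
    (hF : Measurable F) (hFX : Integrable (fun a => F (X a)) P)
    (hle : ∀ x, Integrable (fun y => H (x, y)) (P.map ξ) ∧ ∫ y, H (x, y) ∂(P.map ξ) ≤ F x) :
    Integrable (fun a => H (X a, ξ a)) P ∧ ∫ a, H (X a, ξ a) ∂P ≤ ∫ a, F (X a) ∂P := by
  have hlaw := (indepFun_iff_map_prod_eq_prod_map_map hX.aemeasurable hξ.aemeasurable).1 hind
  have hXξ : Measurable fun a => (X a, ξ a) := hX.prodMk hξ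
  have := Measure.isProbabilityMeasure_map (μ := P) hX.aemeasurable
  have := Measure.isProbabilityMeasure_map (μ := P) hξ.aemeasurable
  have hFint : Integrable F (P.map X) :=
    (integrable_map_measure hF.aestronglyMeasurable hX.aemeasurable).2 hFX
  have hprod : Integrable H ((P.map X).prod (P.map ξ)) := by
    refine (integrable_prod_iff hH.aestronglyMeasurable).2
      ⟨Filter.Eventually.of_forall fun x => (hle x).1, ?_⟩
    simp_rw [fun z => Real.norm_of_nonneg (hH0 z)]
    refine hFint.mono' hH.stronglyMeasurable.integral_prod_right'.aestronglyMeasurable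
      (Filter.Eventually.of_forall fun x => ?_)
    rw [Real.norm_of_nonneg (integral_nonneg fun y => hH0 _)]
    exact (hle x).2
  have hmap : Integrable H (P.map fun a => (X a, ξ a)) := by rwa [hlaw]
  refine ⟨(integrable_map_measure hH.aestronglyMeasurable hXξ.aemeasurable).1 hmap, ?_⟩
  rw [← integral_map hXξ.aemeasurable hH.aestronglyMeasurable, hlaw, integral_prod _ hprod,
    ← integral_map hX.aemeasurable hF.aestronglyMeasurable]
  exact integral_mono hprod.integral_prod_left hFint fun x => (hle x).2

end Independence

/-! ### The run as a Markov chain -/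

section Draws

variable {V : Type*} {D : ℕ} {m : V → ℕ} {ν σ : ℝ} {Ω : Type*}
  {I : ∀ (_ : ℕ) (v : V), Ω → Fin (m v)} {η : ℕ → V → Ω → EuclideanSpace ℝ (Fin D)}

/-- The σ-algebra generated by the draws whose iteration number lies in `S`. -/
abbrev drawsSigma (I : ∀ (_ : ℕ) (v : V), Ω → Fin (m v))
    (η : ℕ → V → Ω → EuclideanSpace ℝ (Fin D)) (S : Set ℕ) : MeasurableSpace Ω :=
  ⨆ j ∈ {j : ℕ × V | j.1 ∈ S},
    MeasurableSpace.comap (fun a => (I j.1 j.2 a, η j.1 j.2 a)) inferInstance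

lemma drawsSigma_mono {S S' : Set ℕ} (h : S ⊆ S') : drawsSigma I η S ≤ drawsSigma I η S' :=
  biSup_mono fun _ hj => h hj

lemma measurable_draws {S : Set ℕ} {t : ℕ} (ht : t ∈ S) :
    Measurable[drawsSigma I η S] fun a v => (I t v a, η t v a) := by
  refine @measurable_pi_lambda _ _ _ (drawsSigma I η S) _ _ fun v => ?_
  exact (comap_measurable fun a => (I t v a, η t v a)).mono
    (le_iSup₂_of_le (t, v) ht le_rfl) le_rfl

variable [MeasurableSpace Ω] {P : Measure Ω}

namespace IsRunRandomness

lemma drawsSigma_le (hR : IsRunRandomness P ν σ I η) (S : Set ℕ) :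
    drawsSigma I η S ≤ ‹MeasurableSpace Ω› :=
  iSup₂_le fun j _ => ((hR.measurable_sample j.1 j.2).prodMk (hR.measurable_noise j.1 j.2)).comap_le

lemma measurable_draws (hR : IsRunRandomness P ν σ I η) (t : ℕ) :
    Measurable fun a v => (I t v a, η t v a) :=
  measurable_pi_lambda _ fun v => (hR.measurable_sample t v).prodMk (hR.measurable_noise t v)

lemma indepFun_of_measurable (hR : IsRunRandomness P ν σ I η) {t : ℕ} {S : Type*}
    [MeasurableSpace S] {Y : Ω → S} (hY : Measurable[drawsSigma I η (Set.Iio t)] Y) :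
    IndepFun Y (fun a v => (I t v a, η t v a)) P := by
  have hdisj : Disjoint {j : ℕ × V | j.1 ∈ Set.Iio t} {j : ℕ × V | j.1 ∈ ({t} : Set ℕ)} :=
    Set.disjoint_left.2 fun j h1 h2 => (Set.mem_Iio.1 h1).ne (Set.mem_singleton_iff.1 h2)
  have hindep : Indep (drawsSigma I η (Set.Iio t)) (drawsSigma I η {t}) P :=
    indep_iSup_of_disjoint
      (m := fun j : ℕ × V =>
        MeasurableSpace.comap (fun a => (I j.1 j.2 a, η j.1 j.2 a)) inferInstance)
      (fun j => ((hR.measurable_sample j.1 j.2).prodMk (hR.measurable_noise j.1 j.2)).comap_le)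
      hR.indep.iIndep hdisj
  rw [IndepFun_iff_Indep]
  have h1 : MeasurableSpace.comap (fun a v => (I t v a, η t v a)) inferInstance
      ≤ drawsSigma I η {t} := (_root_.measurable_draws (Set.mem_singleton t)).comap_le
  exact indep_of_indep_of_le_right (indep_of_indep_of_le_left hindep hY.comap_le) h1

lemma map_draws [Fintype V] [IsProbabilityMeasure P] (hR : IsRunRandomness P ν σ I η) (t : ℕ) :
    P.map (fun a v => (I t v a, η t v a)) = allDrawsLaw m D (ν ^ 2 * σ ^ 2) := by
  have hind : iIndepFun (fun v a => (I t v a, η t v a)) P :=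
    hR.indep.precomp (g := fun v : V => (t, v)) fun v w h => (Prod.mk.inj h).2
  rw [(iIndepFun_iff_map_fun_eq_pi_map fun v =>
    ((hR.measurable_sample t v).prodMk (hR.measurable_noise t v)).aemeasurable).1 hind]
  simp_rw [hR.law]
  rfl

end IsRunRandomness

end Draws

section Run

variable {V : Type*} [Fintype V] [DecidableEq V] {D : ℕ} {X : V → Type*} {m : V → ℕ}
  {data : ∀ v, Fin (m v) → X v} {ℓ : ∀ v, EuclideanSpace ℝ (Fin D) → X v → ℝ}
  {θ₀ : V → EuclideanSpace ℝ (Fin D)} {ν σ : ℝ} {W : ℕ → Matrix V V ℝ} {K : ℕ}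

lemma muffliatoSGD_counters (I : ∀ (_ : ℕ) (v : V), Fin (m v))
    (η : ℕ → V → EuclideanSpace ℝ (Fin D)) (t : ℕ) :
    (muffliatoSGD data ℓ θ₀ ν W K I η t).gradientSteps = t ∧
      (muffliatoSGD data ℓ θ₀ ν W K I η t).communications = t * K := by
  induction t with
  | zero => simp [muffliatoSGD]
  | succ t ih =>
    simp only [muffliatoSGD, muffliato, acceleratedGossip_gradientSteps,
      acceleratedGossip_communications, localGradientStep, ih.1, ih.2]
    exact ⟨trivial, by ring⟩

lemma muffliatoSGD_cur_succ (I : ∀ (_ : ℕ) (v : V), Fin (m v))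
    (η : ℕ → V → EuclideanSpace ℝ (Fin D)) (t : ℕ) :
    (muffliatoSGD data ℓ θ₀ ν W K I η (t + 1)).cur
      = iteration ν (fun v i => ∇ (fun θ => ℓ v θ (data v i))) (W t) K
        (muffliatoSGD data ℓ θ₀ ν W K I η t).cur (fun v => (I t v, η t v)) := by
  funext v
  rw [muffliatoSGD, muffliato, acceleratedGossip_cur]
  rfl

variable {Ω : Type*} {I : ∀ (_ : ℕ) (v : V), Ω → Fin (m v)}
  {η : ℕ → V → Ω → EuclideanSpace ℝ (Fin D)}

lemma measurable_muffliatoSGD_cur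
    (hg : ∀ v i, Continuous (∇ (fun θ => ℓ v θ (data v i)))) (t : ℕ) :
    Measurable[drawsSigma I η (Set.Iio t)] fun a =>
      (muffliatoSGD data ℓ θ₀ ν W K (fun t v => I t v a) (fun t v => η t v a) t).cur := by
  induction t with
  | zero => exact measurable_const
  | succ t ih =>
    simp_rw [muffliatoSGD_cur_succ]
    have h1 := ih.mono (drawsSigma_mono (Set.Iio_subset_Iio (Nat.le_succ t))) le_rfl
    have h2 : Measurable[drawsSigma I η (Set.Iio (t + 1))] fun a v => (I t v a, η t v a) :=
      measurable_draws (Nat.lt_succ_self t)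
    have h3 := (measurable_iteration (ν := ν) hg (W t) K).comp (h1.prodMk h2)
    simp only [Function.comp_def] at h3
    exact h3

variable [MeasurableSpace Ω] {P : Measure Ω}

namespace IsRunRandomness

lemma measurable_cur (hR : IsRunRandomness P ν σ I η)
    (hg : ∀ v i, Continuous (∇ (fun θ => ℓ v θ (data v i)))) (t : ℕ) :
    Measurable fun a =>
      (muffliatoSGD data ℓ θ₀ ν W K (fun t v => I t v a) (fun t v => η t v a) t).cur :=
  (measurable_muffliatoSGD_cur hg t).mono (hR.drawsSigma_le _) le_rfl

/-- The current values depend on past draws only. -/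
lemma indepFun_cur_draws (hR : IsRunRandomness P ν σ I η)
    (hg : ∀ v i, Continuous (∇ (fun θ => ℓ v θ (data v i)))) (t : ℕ) :
    IndepFun (fun a =>
      (muffliatoSGD data ℓ θ₀ ν W K (fun t v => I t v a) (fun t v => η t v a) t).cur)
      (fun a v => (I t v a, η t v a)) P := by
  have h := measurable_muffliatoSGD_cur (θ₀ := θ₀) (ν := ν) (W := W) (K := K) (I := I) (η := η)
    hg t
  exact hR.indepFun_of_measurable h

end IsRunRandomness

end Run

/-! ### Weighted averages along the run -/

/-- Unrolling a perturbed contraction with geometric weights. -/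
lemma weighted_sum_le {ψ f : ℕ → ℝ} {q ν b : ℝ} (hq : 0 < q) (hψ : ∀ t, 0 ≤ ψ t)
    (h : ∀ t, ψ (t + 1) ≤ q * ψ t - ν * f t + b) (T : ℕ) :
    ν * ∑ t ∈ Finset.range T, q⁻¹ ^ (t + 1) * f t
      ≤ ψ 0 + b * ∑ t ∈ Finset.range T, q⁻¹ ^ (t + 1) := by
  have key : ν * ∑ t ∈ Finset.range T, q⁻¹ ^ (t + 1) * f t + q⁻¹ ^ T * ψ T
      ≤ ψ 0 + b * ∑ t ∈ Finset.range T, q⁻¹ ^ (t + 1) := by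
    induction T with
    | zero => simp
    | succ T ih =>
      rw [Finset.sum_range_succ, Finset.sum_range_succ]
      have h1 := mul_le_mul_of_nonneg_left (h T) (show 0 ≤ q⁻¹ ^ (T + 1) by positivity)
      have h2 : q⁻¹ ^ (T + 1) * (q * ψ T) = q⁻¹ ^ T * ψ T := by
        rw [pow_succ]
        field_simp
      nlinarith
  have := mul_nonneg (show 0 ≤ q⁻¹ ^ T by positivity) (hψ T)
  linarith

/-- Jensen's inequality for the weighted average. -/
lemma ConvexOn.weightedAverage_le {D : ℕ} {φ : EuclideanSpace ℝ (Fin D) → ℝ}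
    (hφ : ConvexOn ℝ Set.univ φ) {ω : ℕ → ℝ} (hω : ∀ t, 0 < ω t) {T : ℕ} (hT : 0 < T)
    (y : ℕ → EuclideanSpace ℝ (Fin D)) (c : ℝ) :
    φ (weightedAverage ω y T) - c
      ≤ (∑ t ∈ Finset.range T, ω t)⁻¹ * ∑ t ∈ Finset.range T, ω t * (φ (y t) - c) := by
  have hne : (Finset.range T).Nonempty := Finset.nonempty_range_iff.2 hT.ne'
  have hpos : 0 < ∑ t ∈ Finset.range T, ω t := Finset.sum_pos (fun t _ => hω t) hne
  have h := hφ.map_centerMass_le (t := Finset.range T) (w := ω) (p := y)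
    (fun t _ => (hω t).le) hpos fun _ _ => Set.mem_univ _
  simp only [Finset.centerMass, smul_eq_mul, Function.comp_apply] at h
  rw [weightedAverage]
  simp_rw [mul_sub, Finset.sum_sub_distrib, ← Finset.sum_mul, mul_sub]
  rw [inv_mul_cancel_left₀ hpos.ne']
  linarith

/-! ### Utility for a given step size -/

section Utility

universe w

variable {V : Type*} [Fintype V] {D : ℕ} {X : V → Type*} {m : V → ℕ}
  {data : ∀ v, Fin (m v) → X v} {ℓ : ∀ v, EuclideanSpace ℝ (Fin D) → X v → ℝ}

lemma AchievesUtility.mono [DecidableEq V] {s : EuclideanSpace ℝ (Fin D)} {θ₀ : V → EuclideanSpace ℝ (Fin D)}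
    {σ : ℝ} {W : ℕ → Matrix V V ℝ} {K T : ℕ} {b b' : ℝ}
    (h : AchievesUtility.{w} data ℓ s θ₀ σ W K T b) (hb : b ≤ b') :
    AchievesUtility.{w} data ℓ s θ₀ σ W K T b' := by
  obtain ⟨ν, hν, ω, hω, H⟩ := h
  refine ⟨ν, hν, ω, hω, fun Ω _ P _ I η hR => ?_⟩
  obtain ⟨h1, h2, h3⟩ := H Ω P I η hR
  exact ⟨h1, h2, h3.trans hb⟩

lemma globalObjective_eq_averageObjective :
    globalObjective data ℓ = averageObjective fun v i θ => ℓ v θ (data v i) := by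
  funext θ
  simp [globalObjective, localObjective, averageObjective, uniformMean]

lemma continuous_weightedAverage (ω : ℕ → ℝ) (T : ℕ) :
    Continuous fun y : ℕ → EuclideanSpace ℝ (Fin D) => weightedAverage ω y T := by
  unfold weightedAverage
  fun_prop

variable [DecidableEq V] [Nonempty V] [∀ v, NeZero (m v)] {L μ : ℝ} {s : EuclideanSpace ℝ (Fin D)} {ζ ρ : V → ℝ}

/-- The utility of a run with a given step size `ν ≤ 1 / (8 L)` and weights growing geometrically
at the rate of the contraction: a bias that decays exponentially and a variance of order
`ν B / n`. -/
lemma IsRegularProblem.achievesUtility_of_stepSize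
    (hf : IsRegularProblem (fun v i θ => ℓ v θ (data v i)) L μ s ζ ρ) (hD : 0 < D) (hμ : 0 < μ)
    {G : ℕ → SimpleGraph V} {W : ℕ → Matrix V V ℝ} (hW : ∀ t, IsGossipMatrix (G t) (W t))
    (hc : ∀ t, (communicationGraph (W t)).Connected) (hgap : ∀ t, 0 < spectralGap (W t))
    {θ₀ : V → EuclideanSpace ℝ (Fin D)} {K : ℕ} {ν σ α B : ℝ} (hν : 0 < ν)
    (hνL : ν * L ≤ 1 / 8) (hB : B = D * σ ^ 2 + uniformMean fun v => ρ v ^ 2)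
    (hα : ∀ t, 2 * Real.exp (-(2 * (K * Real.sqrt (spectralGap (W t))))) ≤ α) (hα2 : α ≤ 1 / 2)
    (hαB : α * (uniformMean (fun v => ζ v ^ 2) + B) ≤ 4 * B * (Fintype.card V : ℝ)⁻¹)
    {T : ℕ} (hT : 0 < T) :
    AchievesUtility data ℓ s θ₀ σ W K T
      (uniformMean (fun v => ‖θ₀ v - s‖ ^ 2) / ν * Real.exp (-(ν * μ * T / 2))
        + 26 * ν * B * (Fintype.card V : ℝ)⁻¹) := by
  have hμL := hf.strong_le_smooth hD
  have hL : 0 < L := hμ.trans_le hμL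
  set q : ℝ := 1 - ν * μ / 2 with hq
  have hνμ : ν * μ ≤ 1 / 8 := (mul_le_mul_of_nonneg_left hμL hν.le).trans hνL
  have hνμ0 : 0 < ν * μ := mul_pos hν hμ
  have hq0 : 0 < q := by rw [hq]; linarith
  have hq1 : q ≤ Real.exp (-(ν * μ / 2)) := by
    rw [hq]; linarith [Real.add_one_le_exp (-(ν * μ / 2))]
  have hω (t : ℕ) : 0 < q⁻¹ ^ (t + 1) := by positivity
  refine ⟨ν, hν, fun t => q⁻¹ ^ (t + 1), hω, fun Ω _ P _ I η hR => ?_⟩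
  intro run gap
  refine ⟨fun a => muffliatoSGD_counters _ _ T, ?_⟩
  set f : ∀ v, Fin (m v) → EuclideanSpace ℝ (Fin D) → ℝ := fun v i θ => ℓ v θ (data v i) with hfdef
  set b : ℝ := 26 * ν ^ 2 * B * (Fintype.card V : ℝ)⁻¹ with hb
  have hg (v : V) (i : Fin (m v)) : Continuous (∇ (f v i)) := (hf.smooth v i).continuous_gradient
  have hφc := hf.continuous_averageObjective
  have hmeas (t : ℕ) : Measurable fun a => (run a t).cur := hR.measurable_cur hg t
  have ha : 0 ≤ 8 * (ν * L) := by positivity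
  have hgapm : Measurable fun θ : V → EuclideanSpace ℝ (Fin D) =>
      averageObjective f (nodeMean θ) - averageObjective f s :=
    ((hφc.comp continuous_nodeMean).sub continuous_const).measurable
  -- the sub-optimality of the mean is dominated by the Lyapunov function
  have hgapint (t : ℕ) (h : Integrable (fun a => lyapunov (8 * (ν * L)) s (run a t).cur) P) :
      Integrable (fun a => averageObjective f (nodeMean (run a t).cur) - averageObjective f s) P := by
    refine (h.const_mul (L / 2)).mono' (hgapm.comp (hmeas t)).aestronglyMeasurable
      (Filter.Eventually.of_forall fun a => ?_)
    rw [Real.norm_of_nonneg (hf.gap_nonneg _)]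
    refine (hf.gap_le _).trans (mul_le_mul_of_nonneg_left ?_ (by positivity))
    exact le_add_of_nonneg_right
      (mul_nonneg ha (uniformMean_nonneg fun v => sq_nonneg _))
  have hstep (t : ℕ) (h : Integrable (fun a => lyapunov (8 * (ν * L)) s (run a t).cur) P) :
      Integrable (fun a => lyapunov (8 * (ν * L)) s (run a (t + 1)).cur) P ∧
        ∫ a, lyapunov (8 * (ν * L)) s (run a (t + 1)).cur ∂P
          ≤ q * ∫ a, lyapunov (8 * (ν * L)) s (run a t).cur ∂P
            - ν * ∫ a, (averageObjective f (nodeMean (run a t).cur) - averageObjective f s) ∂P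
            + b := by
    have hone := hf.expected_lyapunov_iteration (K := K) hD hμ (hW t) (hc t) (hgap t) hν hνL hB
      (hα t) hα2 hαB
    rw [← hR.map_draws t] at hone
    have hint := hgapint t h
    have hF : Integrable (fun a => q * lyapunov (8 * (ν * L)) s (run a t).cur
        - ν * (averageObjective f (nodeMean (run a t).cur) - averageObjective f s) + b) P :=
      ((h.const_mul q).sub (hint.const_mul ν)).add (integrable_const b)
    have hav := integral_le_of_indepFun (hmeas t) (hR.measurable_draws t)
      (hR.indepFun_cur_draws hg t) (measurable_lyapunov_iteration (ν := ν) hg (W t) K _ s)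
      (fun z => lyapunov_nonneg ha _ _)
      (F := fun θ => q * lyapunov (8 * (ν * L)) s θ
        - ν * (averageObjective f (nodeMean θ) - averageObjective f s) + b)
      ((((measurable_lyapunov _ s).const_mul q).sub (hgapm.const_mul ν)).add_const b) hF hone
    have hsucc (a : Ω) : (run a (t + 1)).cur
        = iteration ν (fun v i => ∇ (f v i)) (W t) K (run a t).cur (fun v => (I t v a, η t v a)) :=
      muffliatoSGD_cur_succ _ _ t
    simp_rw [hsucc]
    refine ⟨hav.1, hav.2.trans_eq ?_⟩
    have hsub : Integrable (fun a => q * lyapunov (8 * (ν * L)) s (run a t).cur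
        - ν * (averageObjective f (nodeMean (run a t).cur) - averageObjective f s)) P :=
      (h.const_mul q).sub (hint.const_mul ν)
    rw [integral_add hsub (integrable_const b),
      integral_sub (h.const_mul q) (hint.const_mul ν), integral_const_mul, integral_const_mul]
    simp
  have hψint (t : ℕ) : Integrable (fun a => lyapunov (8 * (ν * L)) s (run a t).cur) P := by
    induction t with
    | zero =>
      have : Integrable (fun _ : Ω => lyapunov (8 * (ν * L)) s θ₀) P := integrable_const _
      exact this
    | succ t ih => exact (hstep t ih).1
  have hsum := weighted_sum_le (T := T) hq0
    (fun t => integral_nonneg fun a => lyapunov_nonneg ha s (run a t).cur)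
    (fun t => (hstep t (hψint t)).2)
  have hψ0 : ∫ a, lyapunov (8 * (ν * L)) s (run a 0).cur ∂P
      ≤ uniformMean fun v => ‖θ₀ v - s‖ ^ 2 := by
    have : ∫ _ : Ω, lyapunov (8 * (ν * L)) s θ₀ ∂P ≤ uniformMean fun v => ‖θ₀ v - s‖ ^ 2 := by
      simpa using lyapunov_le (by linarith) s θ₀
    exact this
  -- Jensen's inequality
  have hconv : ConvexOn ℝ Set.univ (averageObjective f) :=
    hf.strong.convexOn fun r => by positivity
  have hJ (a : Ω) : gap a ≤ (∑ t ∈ Finset.range T, q⁻¹ ^ (t + 1))⁻¹ * ∑ t ∈ Finset.range T,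
      q⁻¹ ^ (t + 1) * (averageObjective f (nodeMean (run a t).cur) - averageObjective f s) := by
    simp only [gap, globalObjective_eq_averageObjective]
    exact hconv.weightedAverage_le hω hT _ _
  have hUint : Integrable (fun a => (∑ t ∈ Finset.range T, q⁻¹ ^ (t + 1))⁻¹ *
      ∑ t ∈ Finset.range T,
        q⁻¹ ^ (t + 1) * (averageObjective f (nodeMean (run a t).cur) - averageObjective f s)) P :=
    (integrable_finsetSum _ fun t _ => (hgapint t (hψint t)).const_mul _).const_mul _
  have hgm : Measurable gap := by
    simp only [gap, globalObjective_eq_averageObjective]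
    refine (hφc.measurable.comp ?_).sub_const _
    exact (continuous_weightedAverage _ T).measurable.comp
      (measurable_pi_lambda _ fun t => continuous_nodeMean.measurable.comp (hmeas t))
  have hgi : Integrable gap P := by
    refine hUint.mono' hgm.aestronglyMeasurable (Filter.Eventually.of_forall fun a => ?_)
    rw [Real.norm_of_nonneg]
    · exact hJ a
    · simp only [gap, globalObjective_eq_averageObjective]
      exact hf.gap_nonneg _
  refine ⟨hgi, (integral_mono hgi hUint hJ).trans ?_⟩
  rw [integral_const_mul, integral_finsetSum _ fun t _ => (hgapint t (hψint t)).const_mul _]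
  simp_rw [integral_const_mul]
  set Ω' := ∑ t ∈ Finset.range T, q⁻¹ ^ (t + 1) with hΩ'
  set R := uniformMean fun v => ‖θ₀ v - s‖ ^ 2 with hRdef
  have hR0 : 0 ≤ R := uniformMean_nonneg fun v => sq_nonneg _
  have hΩ : Real.exp (ν * μ * T / 2) ≤ Ω' := by
    have h1 : q⁻¹ ^ T ≤ Ω' := by
      have : q⁻¹ ^ (T - 1 + 1) ≤ Ω' := Finset.single_le_sum (f := fun t => q⁻¹ ^ (t + 1)) (fun t _ => (hω t).le)
        (Finset.mem_range.2 (Nat.sub_lt hT one_pos))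
      rwa [Nat.sub_add_cancel hT] at this
    refine le_trans ?_ h1
    have h2 : Real.exp (ν * μ / 2) ≤ q⁻¹ := by
      rw [← inv_inv (Real.exp (ν * μ / 2)), ← Real.exp_neg]
      exact inv_anti₀ hq0 hq1
    calc Real.exp (ν * μ * T / 2) = Real.exp (ν * μ / 2) ^ T := by
          rw [← Real.exp_nat_mul]; ring_nf
      _ ≤ q⁻¹ ^ T := pow_le_pow_left₀ (Real.exp_pos _).le h2 T
  have hΩ0 : 0 < Ω' := (Real.exp_pos _).trans_le hΩ
  have hinv : Ω'⁻¹ ≤ Real.exp (-(ν * μ * T / 2)) := by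
    rw [Real.exp_neg]
    exact inv_anti₀ (Real.exp_pos _) hΩ
  have h1 : Ω'⁻¹ * (R / ν) ≤ Real.exp (-(ν * μ * T / 2)) * (R / ν) :=
    mul_le_mul_of_nonneg_right hinv (by positivity)
  refine le_trans (b := Ω'⁻¹ * (R / ν) + b / ν) ?_ ?_
  · rw [inv_mul_le_iff₀ hΩ0, mul_add, mul_inv_cancel_left₀ hΩ0.ne', ← mul_div_assoc, ← add_div,
      le_div_iff₀ hν]
    linarith
  · have h2 : b / ν = 26 * ν * B * (Fintype.card V : ℝ)⁻¹ := by
      rw [hb]; field_simp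
    rw [h2]
    linarith

end Utility

/-! ### Choice of the step size and of the stopping time -/

lemma half_le_log {x : ℝ} (hx : 2 ≤ x) : 1 / 2 ≤ Real.log x := by
  have := Real.log_le_log two_pos hx
  linarith [Real.log_two_gt_d9]

/-- The step size `min (1 / (8 L), 2 ln A / (μ T))` balances bias and variance. -/
lemma exists_stepSize {L μ B n R T : ℝ} (hμ : 0 < μ) (hμL : μ ≤ L) (hB : 0 < B) (hn : 0 < n)
    (hR : 0 ≤ R) (hT : 0 < T) : ∃ ν : ℝ, 0 < ν ∧ ν * L ≤ 1 / 8 ∧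
      R / ν * Real.exp (-(ν * μ * T / 2)) + 26 * ν * B * n⁻¹
        ≤ 54 * (B / (n * μ * T) * Real.log (2 + n * μ ^ 2 * R * T ^ 2 / B)
          + L * R * Real.exp (-(1 / 16 * T / (L / μ)))) := by
  have hL : 0 < L := hμ.trans_le hμL
  set A := 2 + n * μ ^ 2 * R * T ^ 2 / B with hA
  have hA2 : 2 ≤ A := by rw [hA]; linarith [show 0 ≤ n * μ ^ 2 * R * T ^ 2 / B by positivity]
  have hlog := half_le_log hA2
  have hE := Real.exp_pos (-(1 / 16 * T / (L / μ)))
  have hLR : 0 ≤ L * R * Real.exp (-(1 / 16 * T / (L / μ))) := by positivity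
  rcases le_total (1 / (8 * L)) (2 * Real.log A / (μ * T)) with h | h
  · refine ⟨1 / (8 * L), by positivity, by field_simp; norm_num, ?_⟩
    have e1 : R / (1 / (8 * L)) * Real.exp (-(1 / (8 * L) * μ * T / 2))
        = 8 * (L * R * Real.exp (-(1 / 16 * T / (L / μ)))) := by
      have : 1 / (8 * L) * μ * T / 2 = 1 / 16 * T / (L / μ) := by field_simp; norm_num
      rw [this]
      field_simp
    have e2 : 26 * (1 / (8 * L)) * B * n⁻¹ ≤ 52 * (B / (n * μ * T) * Real.log A) := by
      have h1 := mul_le_mul_of_nonneg_left h (show 0 ≤ 26 * (B * n⁻¹) by positivity)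
      have h2 : 26 * (B * n⁻¹) * (2 * Real.log A / (μ * T))
          = 52 * (B / (n * μ * T) * Real.log A) := by field_simp; norm_num
      linarith
    have e3 : 0 ≤ B / (n * μ * T) * Real.log A := by positivity
    rw [e1]
    linarith
  · have hν : 0 < 2 * Real.log A / (μ * T) := by positivity
    refine ⟨2 * Real.log A / (μ * T), hν, ?_, ?_⟩
    · have := mul_le_mul_of_nonneg_right h hL.le
      have e : 1 / (8 * L) * L = 1 / 8 := by field_simp
      linarith
    · have e0 : 2 * Real.log A / (μ * T) * μ * T / 2 = Real.log A := by field_simp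
      have e2 : 26 * (2 * Real.log A / (μ * T)) * B * n⁻¹
          = 52 * (B / (n * μ * T) * Real.log A) := by field_simp; norm_num
      rw [e0, e2, Real.exp_neg, Real.exp_log (by linarith)]
      have e1 : R / (2 * Real.log A / (μ * T)) * A⁻¹ ≤ 2 * (B / (n * μ * T) * Real.log A) := by
        have h1 : R * (μ * T) * A⁻¹ ≤ B / (n * μ * T) := by
          rw [← div_eq_mul_inv, div_le_div_iff₀ (by linarith) (by positivity)]
          have h2 : B * A = 2 * B + n * μ ^ 2 * R * T ^ 2 := by rw [hA]; field_simp
          rw [h2]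
          nlinarith
        have h3 : R / (2 * Real.log A / (μ * T)) * A⁻¹
            = R * (μ * T) * A⁻¹ * (2 * Real.log A)⁻¹ := by field_simp
        have h4 : (2 * Real.log A)⁻¹ ≤ 2 * Real.log A := by
          refine (inv_le_one_of_one_le₀ (by linarith)).trans (by linarith)
        have h5 : 0 < A := by linarith
        calc R / (2 * Real.log A / (μ * T)) * A⁻¹
            = R * (μ * T) * A⁻¹ * (2 * Real.log A)⁻¹ := h3
          _ ≤ B / (n * μ * T) * (2 * Real.log A) :=
            mul_le_mul h1 h4 (by positivity) (by positivity)
          _ = _ := by ring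
      linarith

/-- At the stopping time the exponential term is dominated by the other one, and the logarithm of
the horizon is harmless. -/
lemma bound_at_stoppingTime {L μ B n R : ℝ} (hμ : 0 < μ) (hμL : μ ≤ L) (hB : 0 < B) (hn : 0 < n)
    (hR : 0 ≤ R) {T : ℕ} (hT : T = ⌈16 * (L / μ) * Real.log (2 + n * L ^ 2 * R / B)⌉₊) :
    0 < T ∧
    54 * (B / (n * μ * T) * Real.log (2 + n * μ ^ 2 * R * T ^ 2 / B)
        + L * R * Real.exp (-(1 / 16 * T / (L / μ))))
      ≤ 1620 * (B / (μ * n * T) * Real.log (2 + n * L ^ 2 * R / B)) := by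
  have hL : 0 < L := hμ.trans_le hμL
  set M := 2 + n * L ^ 2 * R / B with hM
  have hM0 : 0 ≤ n * L ^ 2 * R / B := by positivity
  have hM2 : 2 ≤ M := by rw [hM]; linarith
  have hlog := half_le_log hM2
  have hκ : 1 ≤ L / μ := (one_le_div hμ).2 hμL
  have hκlog : 1 / 2 ≤ L / μ * Real.log M := by nlinarith
  have hTge : 16 * (L / μ) * Real.log M ≤ T := by rw [hT]; exact Nat.le_ceil _
  have hTle : (T : ℝ) ≤ 18 * (L / μ * Real.log M) := by
    have := Nat.ceil_lt_add_one (show 0 ≤ 16 * (L / μ) * Real.log M by positivity)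
    rw [← hT] at this
    linarith
  have hT0 : (0 : ℝ) < T := by nlinarith
  refine ⟨by exact_mod_cast hT0, ?_⟩
  have hμT : μ * T ≤ 18 * (L * Real.log M) := by
    have := mul_le_mul_of_nonneg_left hTle hμ.le
    have e : μ * (18 * (L / μ * Real.log M)) = 18 * (L * Real.log M) := by field_simp
    linarith
  have hlogA : Real.log (2 + n * μ ^ 2 * R * T ^ 2 / B) ≤ 12 * Real.log M := by
    have hlogM : Real.log M ≤ M := (Real.log_le_sub_one_of_pos (by linarith)).trans (by linarith)
    have h1 : (μ * T) ^ 2 ≤ 324 * L ^ 2 * M ^ 2 := by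
      have h2 : μ * T ≤ 18 * (L * M) :=
        hμT.trans (by nlinarith [mul_le_mul_of_nonneg_left hlogM hL.le])
      calc (μ * T) ^ 2 ≤ (18 * (L * M)) ^ 2 := pow_le_pow_left₀ (by positivity) h2 2
        _ = _ := by ring
    have h3 : 2 + n * μ ^ 2 * R * T ^ 2 / B ≤ M ^ 12 := by
      have h4 : n * μ ^ 2 * R * T ^ 2 / B ≤ 324 * M ^ 2 * (M - 2) := by
        have h5 := mul_le_mul_of_nonneg_left h1 (show 0 ≤ n * R / B by positivity)
        have e1 : n * R / B * (μ * T) ^ 2 = n * μ ^ 2 * R * T ^ 2 / B := by ring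
        have e2 : n * R / B * (324 * L ^ 2 * M ^ 2) = 324 * M ^ 2 * (M - 2) := by
          rw [hM]; ring
        linarith
      have h6 : (2 : ℝ) ^ 9 ≤ M ^ 9 := pow_le_pow_left₀ zero_le_two hM2 9
      have h7 : (2 : ℝ) ^ 9 * M ^ 3 ≤ M ^ 9 * M ^ 3 :=
        mul_le_mul_of_nonneg_right h6 (by positivity)
      have h8 : M ^ 9 * M ^ 3 = M ^ 12 := by ring
      have h9 : 4 ≤ M ^ 2 := by nlinarith
      have h10 : 0 ≤ M ^ 3 := by positivity
      have h11 : 324 * M ^ 2 * (M - 2) = 324 * M ^ 3 - 648 * M ^ 2 := by ring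
      norm_num at h7
      linarith
    calc Real.log (2 + n * μ ^ 2 * R * T ^ 2 / B) ≤ Real.log (M ^ 12) :=
          Real.log_le_log (by positivity) h3
      _ = 12 * Real.log M := by rw [Real.log_pow]; norm_num
  have hexp : L * R * Real.exp (-(1 / 16 * T / (L / μ))) ≤ 18 * (B / (μ * n * T) * Real.log M) := by
    have h1 : Real.exp (-(1 / 16 * T / (L / μ))) ≤ M⁻¹ := by
      have hMexp : M⁻¹ = Real.exp (-Real.log M) := by rw [Real.exp_neg, Real.exp_log (by linarith)]
      rw [hMexp]
      refine Real.exp_le_exp.2 (neg_le_neg ?_)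
      rw [le_div_iff₀ (by positivity)]
      linarith
    have h2 : L * R * M⁻¹ ≤ B / (n * L) := by
      rw [← div_eq_mul_inv, div_le_div_iff₀ (by linarith) (by positivity)]
      have e : B * M = 2 * B + n * L ^ 2 * R := by rw [hM]; field_simp
      rw [e]
      nlinarith
    have h3 : B / (n * L) ≤ 18 * (B / (μ * n * T) * Real.log M) := by
      have h4 := mul_le_mul_of_nonneg_left hμT (show 0 ≤ B / (n * L * (μ * T)) by positivity)
      have e1 : B / (n * L * (μ * T)) * (μ * T) = B / (n * L) := by field_simp
      have e2 : B / (n * L * (μ * T)) * (18 * (L * Real.log M))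
          = 18 * (B / (μ * n * T) * Real.log M) := by field_simp
      linarith
    exact ((mul_le_mul_of_nonneg_left h1 (by positivity)).trans h2).trans h3
  have hvar : B / (n * μ * T) * Real.log (2 + n * μ ^ 2 * R * T ^ 2 / B)
      ≤ 12 * (B / (μ * n * T) * Real.log M) := by
    have h1 := mul_le_mul_of_nonneg_left hlogA (show 0 ≤ B / (n * μ * T) by positivity)
    have e : B / (n * μ * T) * (12 * Real.log M) = 12 * (B / (μ * n * T) * Real.log M) := by
      rw [mul_comm n μ]; ring
    linarith
  linarith

theorem theorem5 :
    -- absolute constants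
    ∃ C₁ C₂ c : ℝ, 0 < C₁ ∧ 0 < C₂ ∧ 0 < c ∧
    ∀ {V : Type*} [Fintype V] [DecidableEq V] {D : ℕ} (_hD : 0 < D)
      -- local datasets and losses
      {X : V → Type*} {m : V → ℕ} (_hm : ∀ v, 0 < m v) (data : ∀ v, Fin (m v) → X v)
      (ℓ : ∀ v, EuclideanSpace ℝ (Fin D) → X v → ℝ)
      -- regularity: convex and `L`-smooth local losses, `μ`-strongly convex objective
      (L μ : ℝ) (_hμ : 0 < μ)
      (_hconvex : ∀ v i, ConvexOn ℝ Set.univ (fun θ => ℓ v θ (data v i)))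
      (_hsmooth : ∀ v i, IsLSmooth L (fun θ => ℓ v θ (data v i)))
      (_hstrong : StrongConvexOn Set.univ μ (globalObjective data ℓ))
      -- minimizer, heterogeneity and gradient noise at the minimizer
      (θstar : EuclideanSpace ℝ (Fin D))
      (_hmin : ∀ θ, globalObjective data ℓ θstar ≤ globalObjective data ℓ θ)
      (ζ ρ : V → ℝ)
      (_hζ : ∀ v, ‖∇ (localObjective data ℓ v) θstar - ∇ (globalObjective data ℓ) θstar‖ ^ 2
        ≤ ζ v ^ 2)
      (_hρ : ∀ v, (m v : ℝ)⁻¹ * ∑ i, ‖∇ (fun θ => ℓ v θ (data v i)) θstar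
          - ∇ (localObjective data ℓ v) θstar‖ ^ 2 ≤ ρ v ^ 2)
      -- gossip matrices
      (G : ℕ → SimpleGraph V) (W : ℕ → Matrix V V ℝ) (_hW : ∀ t, IsGossipMatrix (G t) (W t))
      (_hconn : ∀ t, (communicationGraph (W t)).Connected)
      (gap : ℝ) (_hgap : 0 < gap) (_hgapW : ∀ t, gap ≤ spectralGap (W t))
      -- noise level, initial points, number of gossip rounds per iteration
      (σ : ℝ) (θ₀ : V → EuclideanSpace ℝ (Fin D)) (K : ℕ) (n ζ2 B R κ : ℝ)
      (_hn : n = Fintype.card V) (_hζ2 : ζ2 = n⁻¹ * ∑ v, ζ v ^ 2)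
      (_hB : B = D * σ ^ 2 + n⁻¹ * ∑ v, ρ v ^ 2) (_hBpos : 0 < B)
      (_hR : R = n⁻¹ * ∑ v, ‖θ₀ v - θstar‖ ^ 2) (_hκ : κ = L / μ)
      (_hK : ⌈(Real.sqrt gap)⁻¹ * Real.log (max n (ζ2 / B))⌉₊ ≤ K),
      -- bound after any number `T` of iterations
      (∀ T : ℕ, 0 < T →
        AchievesUtility data ℓ θstar θ₀ σ W K T
          (C₂ * (B / (n * μ * T) * Real.log (2 + n * μ ^ 2 * R * T ^ 2 / B)
            + L * R * Real.exp (-(c * T / κ))))) ∧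
      -- bound at the stopping time
      (∀ T : ℕ, T = ⌈C₁ * κ * Real.log (2 + n * L ^ 2 * R / B)⌉₊ →
        AchievesUtility data ℓ θstar θ₀ σ W K T
          (C₂ * (B / (μ * n * T) * Real.log (2 + n * L ^ 2 * R / B)))) := by
  refine ⟨16, 1620, 1 / 16, by norm_num, by norm_num, by norm_num, ?_⟩
  intro V _ _ D hD X m hm data ℓ L μ hμ hconvex hsmooth hstrong s hmin ζ ρ hζ hρ G W hW hconn gap
    hgap hgapW σ θ₀ K n ζ2 B R κ hn hζ2 hB hBpos hR hκ hK
  have hne : Nonempty V := (hconn 0).nonempty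
  have hm' (v : V) : NeZero (m v) := ⟨(hm v).ne'⟩
  have hlocal (v : V) : ∇ (localObjective data ℓ v) s
      = uniformMean fun i => ∇ (fun θ => ℓ v θ (data v i)) s := by
    rw [← gradient_uniformMean fun i => (hsmooth v i).1]
    congr 1
    funext θ
    simp [localObjective, uniformMean]
  have hf : IsRegularProblem (fun v i θ => ℓ v θ (data v i)) L μ s ζ ρ := by
    refine ⟨hconvex, hsmooth, ?_, ?_, fun v => ?_, fun v => ?_⟩
    · rwa [← globalObjective_eq_averageObjective]
    · rwa [← globalObjective_eq_averageObjective]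
    · have := hζ v
      rwa [gradient_eq_zero_of_forall_le hmin, sub_zero, hlocal] at this
    · have := hρ v
      rw [hlocal] at this
      simpa [uniformMean] using this
  have hμL := hf.strong_le_smooth hD
  have hL : 0 < L := hμ.trans_le hμL
  have hgap' (t : ℕ) : 0 < spectralGap (W t) := hgap.trans_le (hgapW t)
  have hn2 : 2 ≤ n := by
    rw [hn]
    exact_mod_cast (hW 0).two_le_card (hgap' 0)
  have hB' : B = D * σ ^ 2 + uniformMean fun v => ρ v ^ 2 := by
    rw [hB, hn]; rfl
  have hζ2' : ζ2 = uniformMean fun v => ζ v ^ 2 := by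
    rw [hζ2, hn]; rfl
  have hR' : R = uniformMean fun v => ‖θ₀ v - s‖ ^ 2 := by
    rw [hR, hn]; rfl
  have hR0 : 0 ≤ R := by
    rw [hR']
    exact uniformMean_nonneg fun v => sq_nonneg _
  -- the gossip rounds contract the squared deviations from the mean by `2 / N²`
  set N := max n (ζ2 / B) with hN
  have hNn : n ≤ N := le_max_left _ _
  have hN0 : 0 < N := by linarith
  have hNζ : ζ2 ≤ N * B := (div_le_iff₀ hBpos).1 (le_max_right _ _)
  have hα (t : ℕ) : 2 * Real.exp (-(2 * (K * Real.sqrt (spectralGap (W t))))) ≤ 2 / N ^ 2 := by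
    have h1 : (Real.sqrt gap)⁻¹ * Real.log N ≤ K := Nat.ceil_le.1 hK
    have h2 : 0 < Real.sqrt gap := Real.sqrt_pos.2 hgap
    rw [inv_mul_le_iff₀ h2] at h1
    have h3 : Real.sqrt gap * K ≤ K * Real.sqrt (spectralGap (W t)) := by
      rw [mul_comm]
      exact mul_le_mul_of_nonneg_left (Real.sqrt_le_sqrt (hgapW t)) (Nat.cast_nonneg K)
    have h4 : Real.exp (-(2 * (K * Real.sqrt (spectralGap (W t))))) ≤ (N ^ 2)⁻¹ := by
      rw [← Real.exp_log (show 0 < N ^ 2 by positivity), ← Real.exp_neg, Real.log_pow]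
      refine Real.exp_le_exp.2 (neg_le_neg ?_)
      push_cast
      linarith
    rw [div_eq_mul_inv]
    linarith
  have hα2 : 2 / N ^ 2 ≤ 1 / 2 := by
    rw [div_le_div_iff₀ (by positivity) two_pos]
    nlinarith
  have hαB : 2 / N ^ 2 * (uniformMean (fun v => ζ v ^ 2) + B)
      ≤ 4 * B * (Fintype.card V : ℝ)⁻¹ := by
    rw [← hζ2', ← hn, ← div_eq_mul_inv, div_mul_eq_mul_div, div_le_div_iff₀ (by positivity)
      (by linarith)]
    have h1 : ζ2 + B ≤ 2 * (N * B) := by nlinarith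
    have h2 : 2 * (ζ2 + B) * n ≤ 2 * (2 * (N * B)) * N :=
      mul_le_mul (by linarith) hNn (by linarith) (by positivity)
    linarith
  have key (T : ℕ) (hT : 0 < T) := exists_stepSize (T := T) (R := R) (n := n) hμ hμL hBpos
    (by linarith) hR0 (by exact_mod_cast hT)
  rw [hκ]
  refine ⟨fun T hT => ?_, fun T hT => ?_⟩
  · obtain ⟨ν, hν, hνL, hbound⟩ := key T hT
    have hutility := hf.achievesUtility_of_stepSize (θ₀ := θ₀) hD hμ hW hconn hgap' hν hνL hB' hα hα2
      hαB hT
    rw [← hR', ← hn] at hutility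
    refine hutility.mono (hbound.trans ?_)
    have h1 : 0 ≤ Real.log (2 + n * μ ^ 2 * R * T ^ 2 / B) := by
      have : 0 ≤ n * μ ^ 2 * R * T ^ 2 / B := by positivity
      linarith [half_le_log (show 2 ≤ 2 + n * μ ^ 2 * R * T ^ 2 / B by linarith)]
    refine mul_le_mul_of_nonneg_right (by norm_num) ?_
    positivity
  · obtain ⟨hT0, hle⟩ := bound_at_stoppingTime hμ hμL hBpos (by linarith) hR0 hT
    obtain ⟨ν, hν, hνL, hbound⟩ := key T hT0
    have hutility := hf.achievesUtility_of_stepSize (θ₀ := θ₀) hD hμ hW hconn hgap' hν hνL hB' hα hα2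
      hαB hT0
    rw [← hR', ← hn] at hutility
    exact hutility.mono (hbound.trans hle)

end
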